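/- Let $n\ge 1$, let $U\subseteq\mathbb{R}^n$ be open, with coordinates $(r,x^2,\dots,x^n)$, and let $\bar g$ be a smooth Riemannian metric on $U$ for which these coordinates are semigeodesic, i.e. $$\bar g=(dr)^2+\sum_{i,j=2}^n\bar g_{ij}(r,x^2,\dots,x^n)\,dx^i dx^j .$$ On the set of all $(r,t,x^2,\dots,x^n)\in\mathbb{R}^{n+1}$ with $(r,0,\dots,0)\in U$ define $$h_{PW}=2\,dr\,dt+\sum_{i,j=2}^n\bar g_{ij}(r,0,\dots,0)\,dx^i dx^j .$$ This is a Lorentzian metric, and it is the plane-wave limit of $-(dt)^2+\bar g$: put $x^0=(r+t)/\sqrt2$, $x^1=(r-t)/\sqrt2$, and for $\varepsilon>0$ let $g_\varepsilon$ be the metric $-(dt)^2+\bar g$ written in the coordinates $(\tilde x^0,\tilde x^1,\tilde x^i)=(x^0,x^1/\varepsilon^2,x^i/\varepsilon)$; then, in the coordinates given by $(\tilde x^0,\tilde x^1,\tilde x^i)=(\sqrt2\,r,\,t/\sqrt2,\,x^i)$ (new $r,t$), the components of $g_\varepsilon/\varepsilon^2$ converge pointwise to those of $h_{PW}$ as $\varepsilon\to0^+$.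 Moreover: 1. If $\bar g$ is Einstein, $\mathrm{Ric}_{\bar g}=\lambda\bar g$ with a constant $\lambda\in\mathbb{R}$, then $\mathrm{Ric}_{h_{PW}}=\lambda\,(dr)^2$. 2. If $\bar g$ is locally symmetric, $\nabla\mathrm{Rm}=0$, then so is $h_{PW}$. 3. If $\bar g$ has parallel Ricci tensor, $\nabla\mathrm{Ric}=0$, then so does $h_{PW}$. -/

import Mathlib

open Filter Topology
open scoped ContDiff

/-! ### Metrics and curvature in coordinates

A coordinate system with index set `ι` has points `p : ι → ℝ`.  A (pseudo-Riemannian) metric is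
given by its matrix of components; it is only considered on an open set of points. -/

/-- A field of matrices of components `g_ij` with respect to coordinates indexed by `ι`. -/
abbrev MetricField (ι : Type) := (ι → ℝ) → Matrix ι ι ℝ

noncomputable section

section Curvature

variable {ι : Type} [Fintype ι] [DecidableEq ι]

/-- The partial derivative `∂_i f`. -/
def partialDeriv (i : ι) (f : (ι → ℝ) → ℝ) (p : ι → ℝ) : ℝ :=
  fderiv ℝ f p (Pi.single i 1)

/-- The Christoffel symbols of the Levi-Civita connection,
`Γ^k_ij = ½ g^kl (∂_i g_jl + ∂_j g_il - ∂_l g_ij)`. -/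
def christoffel (g : MetricField ι) (k i j : ι) (p : ι → ℝ) : ℝ :=
  (1 / 2 : ℝ) * ∑ l, (g p)⁻¹ k l *
    (partialDeriv i (fun q => g q j l) p + partialDeriv j (fun q => g q i l) p
      - partialDeriv l (fun q => g q i j) p)

/-- The components of the curvature endomorphism
`R(∂_i, ∂_j) ∂_k = ∇_i ∇_j ∂_k - ∇_j ∇_i ∂_k = R^l_ijk ∂_l`. -/
def curvatureEndo (g : MetricField ι) (l i j k : ι) (p : ι → ℝ) : ℝ :=
  partialDeriv i (christoffel g l j k) p - partialDeriv j (christoffel g l i k) p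
    + ∑ a, (christoffel g l i a p * christoffel g a j k p
        - christoffel g l j a p * christoffel g a i k p)

/-- The curvature 4-tensor `Rm_ijkl = g(R(∂_i, ∂_j) ∂_k, ∂_l)`. -/
def riemannTensor (g : MetricField ι) (i j k l : ι) (p : ι → ℝ) : ℝ :=
  ∑ a, curvatureEndo g a i j k p * g p a l

/-- The Ricci tensor `Ric(Y, Z) = tr (X ↦ R(X, Y) Z)`. -/
def ricci (g : MetricField ι) (j k : ι) (p : ι → ℝ) : ℝ :=
  ∑ a, curvatureEndo g a a j k p

/-- The components `(∇_a Ric)_ij`. -/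
def covDerivRicci (g : MetricField ι) (a i j : ι) (p : ι → ℝ) : ℝ :=
  partialDeriv a (ricci g i j) p
    - ∑ b, christoffel g b a i p * ricci g b j p
    - ∑ b, christoffel g b a j p * ricci g i b p

/-- The components `(∇_a Rm)_ijkl`. -/
def covDerivRiemann (g : MetricField ι) (a i j k l : ι) (p : ι → ℝ) : ℝ :=
  partialDeriv a (riemannTensor g i j k l) p
    - ∑ b, christoffel g b a i p * riemannTensor g b j k l p
    - ∑ b, christoffel g b a j p * riemannTensor g i b k l p
    - ∑ b, christoffel g b a k p * riemannTensor g i j b l p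
    - ∑ b, christoffel g b a l p * riemannTensor g i j k b p

/-- `g` is a smooth Riemannian metric on `U`. -/
def IsRiemannianOn (g : MetricField ι) (U : Set (ι → ℝ)) : Prop :=
  (∀ i j, ContDiffOn ℝ ∞ (fun p => g p i j) U) ∧ ∀ p ∈ U, (g p).PosDef

/-- `g` is a smooth Lorentzian metric on `U`: at each point it is congruent to
`diag(1, …, 1, -1, 1, …, 1)` with exactly one entry `-1`. -/
def IsLorentzianOn (g : MetricField ι) (U : Set (ι → ℝ)) : Prop :=
  (∀ i j, ContDiffOn ℝ ∞ (fun p => g p i j) U) ∧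
    ∀ p ∈ U, ∃ (i₀ : ι) (P : Matrix ι ι ℝ), IsUnit P.det ∧
      P.transpose * g p * P = Matrix.diagonal (fun i => if i = i₀ then (-1 : ℝ) else 1)

/-- `Ric = lam • g` on `U`, with a constant `lam`. -/
def IsEinsteinOn (g : MetricField ι) (U : Set (ι → ℝ)) (lam : ℝ) : Prop :=
  ∀ p ∈ U, ∀ i j, ricci g i j p = lam * g p i j

/-- `∇ Rm = 0` on `U`. -/
def IsLocallySymmetricOn (g : MetricField ι) (U : Set (ι → ℝ)) : Prop :=
  ∀ p ∈ U, ∀ a i j k l, covDerivRiemann g a i j k l p = 0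

/-- `∇ Ric = 0` on `U`. -/
def HasParallelRicciOn (g : MetricField ι) (U : Set (ι → ℝ)) : Prop :=
  ∀ p ∈ U, ∀ a i j, covDerivRicci g a i j p = 0

end Curvature

/-- The pullback `F^* g` of a metric in coordinates indexed by `κ` along a map `F` from
coordinates indexed by `ι`: `(F^* g)_ij(p) = ∂_i F^a(p) ∂_j F^b(p) g_ab(F p)`. -/
def pullbackMetric {ι κ : Type} [Fintype ι] [DecidableEq ι] [Fintype κ]
    (F : (ι → ℝ) → (κ → ℝ)) (g : MetricField κ) : MetricField ι :=
  fun p => Matrix.of fun i j =>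
    ∑ a, ∑ b, partialDeriv i (fun q => F q a) p * partialDeriv j (fun q => F q b) p * g (F p) a b

/-! ### Semigeodesic coordinates and the plane wave limit

The dimension of the Riemannian manifold is `n = m + 1`. -/

/-- Indices of the coordinates `(r, x²,…,xⁿ)`: `Sum.inl 0` is `r`, `Sum.inr i` are the others. -/
abbrev RiemIdx (m : ℕ) := Fin 1 ⊕ Fin m

/-- Indices of coordinates such as `(r, t, x²,…,xⁿ)` or `(x⁰, x¹, x²,…,xⁿ)`: `Sum.inl 0` and
`Sum.inl 1` are the first two, `Sum.inr i` are the others. -/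
abbrev LorIdx (m : ℕ) := Fin 2 ⊕ Fin m

/-- The coordinates on `U` are semigeodesic: `g = (dr)² + g_ij(r, x²,…,xⁿ) dx^i dx^j`. -/
def IsSemigeodesicOn {m : ℕ} (g : MetricField (RiemIdx m)) (U : Set (RiemIdx m → ℝ)) : Prop :=
  ∀ p ∈ U, g p (Sum.inl 0) (Sum.inl 0) = 1 ∧
    ∀ i : Fin m, g p (Sum.inl 0) (Sum.inr i) = 0 ∧ g p (Sum.inr i) (Sum.inl 0) = 0

/-- The point `(r, 0,…,0)`. -/
def axisPoint (m : ℕ) (r : ℝ) : RiemIdx m → ℝ := Sum.elim (fun _ => r) (fun _ => 0)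

/-- The metric `h_PW = 2 dr dt + g_ij(r, 0,…,0) dx^i dx^j` in the coordinates
`(r, t, x²,…,xⁿ)`. -/
def planeWave {m : ℕ} (g : MetricField (RiemIdx m)) : MetricField (LorIdx m) :=
  fun p => Matrix.fromBlocks !![0, 1; 1, 0] 0 0
    (Matrix.of fun i j => g (axisPoint m (p (Sum.inl 0))) (Sum.inr i) (Sum.inr j))

/-- The points `(r, t, x²,…,xⁿ)` with `(r, 0,…,0) ∈ U`. -/
def planeWaveDomain {m : ℕ} (U : Set (RiemIdx m → ℝ)) : Set (LorIdx m → ℝ) :=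
  {p | axisPoint m (p (Sum.inl 0)) ∈ U}

/-- The components of the one-form `dr` in the coordinates `(r, t, x²,…,xⁿ)`. -/
def drForm {m : ℕ} : LorIdx m → ℝ := Pi.single (Sum.inl 0) 1

/-- The product metric `-(dt)² + g`; its coordinates are `t` (index `Sum.inl 0`) followed by
those of `g`. -/
def productLorentz {ι : Type} (g : MetricField ι) : MetricField (Fin 1 ⊕ ι) :=
  fun p => Matrix.fromBlocks !![-1] 0 0 (g fun i => p (Sum.inr i))

/-- From the null coordinates `x⁰ = (r + t)/√2`, `x¹ = (r - t)/√2`, `x^i` back to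
`(t, r, x^i)`. -/
def fromNullCoords (m : ℕ) (x : LorIdx m → ℝ) : Fin 1 ⊕ RiemIdx m → ℝ :=
  Sum.elim (fun _ => (x (Sum.inl 0) - x (Sum.inl 1)) / √2)
    (Sum.elim (fun _ => (x (Sum.inl 0) + x (Sum.inl 1)) / √2) (fun i => x (Sum.inr i)))

/-- The inverse of `(x⁰, x¹, x^i) ↦ (x⁰, x¹/ε², x^i/ε)`. -/
def penroseScaling (m : ℕ) (ε : ℝ) (x : LorIdx m → ℝ) : LorIdx m → ℝ :=
  Sum.elim ![x (Sum.inl 0), ε ^ 2 * x (Sum.inl 1)] (fun i => ε * x (Sum.inr i))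

/-- The relabeling `(r, t, x^i) ↦ (√2 r, t/√2, x^i)`. -/
def relabel (m : ℕ) (p : LorIdx m → ℝ) : LorIdx m → ℝ :=
  Sum.elim ![√2 * p (Sum.inl 0), p (Sum.inl 1) / √2] (fun i => p (Sum.inr i))

/-- The metric `-(dt)² + g`, written in the null coordinates, pulled back by the Penrose scaling,
divided by `ε²` and relabeled.  Its limit as `ε → 0` is the plane wave limit. -/
def rescaledMetric {m : ℕ} (g : MetricField (RiemIdx m)) (ε : ℝ) : MetricField (LorIdx m) :=
  fun p => (ε ^ 2)⁻¹ •
    pullbackMetric (fun q => fromNullCoords m (penroseScaling m ε (relabel m q)))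
      (productLorentz g) p

end

/-!
Let `S` be the matrix of transverse components `ḡ_ij` and `A = ½ S⁻¹ ∂_r S` the shape operator of
the level sets of `r`. In semigeodesic coordinates the Riccati equation
`R(∂_r, ·) ∂_r = ∂_r A + A² =: K` expresses the radial curvature of `ḡ` by `r`-derivatives of `S`.
The metric `h_PW` has the same `S` along the axis. Its components depend on `r` only and `∂_t` is
null with `h_PW(∂_t, ·) = dr`, so `dr` is parallel, and with `E = S K` one finds `Rm = dr² ∧ E`
(Kulkarni–Nomizu product), `Ric = -tr K dr²`, `∇Rm = dr ⊗ (dr² ∧ ∇_r E)` and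
`∇Ric = -∂_r tr K dr³`. So the Ricci tensor of `h_PW` and the covariant derivatives of its curvature
are determined by the purely radial components of those of `ḡ` along the axis.

For the limit, the coordinate change sends `r`, `t` to `r + ½ε²t`, `r - ½ε²t`, and
`(dr + ½ε²dt)² - (dr - ½ε²dt)² = 2ε² dr dt`.
-/

section MatrixFields

variable {ι κ κ' κ'' : Type}

section PartialDerivatives

variable [DecidableEq ι]

theorem partialDeriv_congr_of_isOpen {f f' : (ι → ℝ) → ℝ} {U : Set (ι → ℝ)} (hU : IsOpen U)
    (h : ∀ q ∈ U, f q = f' q) {p : ι → ℝ} (hp : p ∈ U) (i : ι) :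
    partialDeriv i f p = partialDeriv i f' p := by
  have heq : f =ᶠ[𝓝 p] f' := eventually_of_mem (hU.mem_nhds hp) h
  rw [partialDeriv, partialDeriv, heq.fderiv_eq]

@[simp]
theorem partialDeriv_const (i : ι) (c : ℝ) (p : ι → ℝ) : partialDeriv i (fun _ => c) p = 0 := by
  simp [partialDeriv]

theorem partialDeriv_const_mul [Finite ι] (i : ι) (c : ℝ) (f : (ι → ℝ) → ℝ) (p : ι → ℝ) :
    partialDeriv i (fun q => c * f q) p = c * partialDeriv i f p := by
  have := Fintype.ofFinite ι
  have h : fderiv ℝ (fun q => c * f q) p = c • fderiv ℝ f p :=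
    congrFun (fderiv_const_smul_field c) p
  simp [partialDeriv, h]

theorem partialDeriv_add {f f' : (ι → ℝ) → ℝ} {p : ι → ℝ} [Finite ι]
    (hf : DifferentiableAt ℝ f p) (hf' : DifferentiableAt ℝ f' p) (i : ι) :
    partialDeriv i (fun q => f q + f' q) p = partialDeriv i f p + partialDeriv i f' p := by
  have := Fintype.ofFinite ι
  rw [partialDeriv, fderiv_fun_add hf hf']
  rfl

theorem partialDeriv_sub {f f' : (ι → ℝ) → ℝ} {p : ι → ℝ} [Finite ι]
    (hf : DifferentiableAt ℝ f p) (hf' : DifferentiableAt ℝ f' p) (i : ι) :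
    partialDeriv i (fun q => f q - f' q) p = partialDeriv i f p - partialDeriv i f' p := by
  have := Fintype.ofFinite ι
  rw [partialDeriv, fderiv_fun_sub hf hf']
  rfl

theorem partialDeriv_sum_mul [Finite ι] [Fintype κ] {f f' : κ → (ι → ℝ) → ℝ} {p : ι → ℝ}
    (hf : ∀ a, DifferentiableAt ℝ (f a) p) (hf' : ∀ a, DifferentiableAt ℝ (f' a) p) (i : ι) :
    partialDeriv i (fun q => ∑ a, f a q * f' a q) p =
      ∑ a, partialDeriv i (f a) p * f' a p + ∑ a, f a p * partialDeriv i (f' a) p := by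
  have := Fintype.ofFinite ι
  simp only [partialDeriv]
  rw [fderiv_fun_sum fun a _ => (hf a).fun_mul (hf' a), ← Finset.sum_add_distrib]
  simp [fderiv_fun_mul (hf _) (hf' _), mul_comm, add_comm]

/-- The entrywise partial derivative `∂_i M` of a field of matrices. -/
noncomputable def partialDerivMatrix (i : ι) (M : (ι → ℝ) → Matrix κ κ' ℝ) (p : ι → ℝ) :
    Matrix κ κ' ℝ :=
  Matrix.of fun a b => partialDeriv i (fun q => M q a b) p

@[simp]
theorem partialDerivMatrix_apply (i : ι) (M : (ι → ℝ) → Matrix κ κ' ℝ) (p : ι → ℝ) (a : κ)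
    (b : κ') : partialDerivMatrix i M p a b = partialDeriv i (fun q => M q a b) p :=
  rfl

theorem partialDerivMatrix_congr_of_isOpen {M N : (ι → ℝ) → Matrix κ κ' ℝ} {U : Set (ι → ℝ)}
    (hU : IsOpen U) (h : ∀ q ∈ U, M q = N q) {p : ι → ℝ} (hp : p ∈ U) (i : ι) :
    partialDerivMatrix i M p = partialDerivMatrix i N p := by
  ext a b
  exact partialDeriv_congr_of_isOpen hU (fun q hq => by rw [h q hq]) hp i

theorem partialDerivMatrix_const_smul [Finite ι] (i : ι) (c : ℝ) (M : (ι → ℝ) → Matrix κ κ' ℝ)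
    (p : ι → ℝ) : partialDerivMatrix i (fun q => c • M q) p = c • partialDerivMatrix i M p := by
  ext a b
  exact partialDeriv_const_mul i c _ p

theorem partialDerivMatrix_fromBlocks_zero (i : ι) (J : Matrix κ κ ℝ)
    (S : (ι → ℝ) → Matrix κ' κ' ℝ) (p : ι → ℝ) :
    partialDerivMatrix i (fun q => Matrix.fromBlocks J 0 0 (S q)) p =
      Matrix.fromBlocks 0 0 0 (partialDerivMatrix i S p) := by
  ext (a | a) (b | b) <;> simp

theorem isSymm_partialDerivMatrix {M : (ι → ℝ) → Matrix κ κ ℝ} {U : Set (ι → ℝ)}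
    (hU : IsOpen U) (hM : ∀ q ∈ U, (M q).IsSymm) (i : ι) {p : ι → ℝ} (hp : p ∈ U) :
    (partialDerivMatrix i M p).IsSymm :=
  partialDerivMatrix_congr_of_isOpen (N := M) hU hM hp i

end PartialDerivatives

/-- The field of matrices `M` is smooth on `U`. Smoothness is stated entry by entry, since matrices
carry no canonical norm. -/
def SmoothEntriesOn {E : Type*} [NormedAddCommGroup E] [NormedSpace ℝ E] (M : E → Matrix κ κ' ℝ)
    (U : Set E) : Prop :=
  ∀ a b, ContDiffOn ℝ ∞ (fun p => M p a b) U

namespace SmoothEntriesOn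

variable {E : Type*} [NormedAddCommGroup E] [NormedSpace ℝ E] {U : Set E}

theorem differentiableAt {M : E → Matrix κ κ' ℝ} (hM : SmoothEntriesOn M U) (hU : IsOpen U)
    {p : E} (hp : p ∈ U) (a : κ) (b : κ') : DifferentiableAt ℝ (fun q => M q a b) p :=
  ((hM a b).contDiffAt (hU.mem_nhds hp)).differentiableAt (by simp)

theorem add {M N : E → Matrix κ κ' ℝ} (hM : SmoothEntriesOn M U) (hN : SmoothEntriesOn N U) :
    SmoothEntriesOn (fun p => M p + N p) U :=
  fun a b => (hM a b).add (hN a b)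

theorem const_smul {M : E → Matrix κ κ' ℝ} (hM : SmoothEntriesOn M U) (c : ℝ) :
    SmoothEntriesOn (fun p => c • M p) U :=
  fun a b => contDiffOn_const.mul (hM a b)

theorem mul [Fintype κ'] {M : E → Matrix κ κ' ℝ} {N : E → Matrix κ' κ'' ℝ}
    (hM : SmoothEntriesOn M U) (hN : SmoothEntriesOn N U) :
    SmoothEntriesOn (fun p => M p * N p) U :=
  fun a b => ContDiffOn.sum fun c _ => (hM a c).mul (hN c b)

theorem det [Fintype κ] [DecidableEq κ] {M : E → Matrix κ κ ℝ} (hM : SmoothEntriesOn M U) :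
    ContDiffOn ℝ ∞ (fun p => (M p).det) U := by
  simp only [Matrix.det_apply']
  exact ContDiffOn.sum fun σ _ => contDiffOn_const.mul (contDiffOn_prod fun a _ => hM (σ a) a)

theorem inv [Fintype κ] [DecidableEq κ] {M : E → Matrix κ κ ℝ} (hM : SmoothEntriesOn M U)
    (hdet : ∀ p ∈ U, IsUnit (M p).det) : SmoothEntriesOn (fun p => (M p)⁻¹) U := by
  intro a b
  have hcofactor : SmoothEntriesOn (fun p => (M p).updateRow b (Pi.single a 1)) U := by
    intro c d
    obtain rfl | hc := eq_or_ne c b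
    · simpa only [Matrix.updateRow_self] using contDiffOn_const
    · simpa only [Matrix.updateRow_ne hc] using hM c d
  simp only [Matrix.inv_def, Matrix.smul_apply, Matrix.adjugate_apply, smul_eq_mul,
    Ring.inverse_eq_inv']
  exact (hM.det.inv fun p hp => (hdet p hp).ne_zero).mul hcofactor.det

theorem comp {E' : Type*} [NormedAddCommGroup E'] [NormedSpace ℝ E'] {M : E → Matrix κ κ' ℝ}
    (hM : SmoothEntriesOn M U) {f : E' → E} (hf : ContDiff ℝ ∞ f) :
    SmoothEntriesOn (fun p => M (f p)) (f ⁻¹' U) :=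
  fun a b => (hM a b).comp hf.contDiffOn fun _ hp => hp

theorem fromBlocks_zero {S : E → Matrix κ' κ' ℝ} (hS : SmoothEntriesOn S U) (J : Matrix κ κ ℝ) :
    SmoothEntriesOn (fun p => Matrix.fromBlocks J 0 0 (S p)) U := by
  rintro (i | i) (j | j)
  exacts [contDiffOn_const, contDiffOn_const, contDiffOn_const, hS i j]

protected theorem partialDerivMatrix [Fintype ι] [DecidableEq ι] {M : (ι → ℝ) → Matrix κ κ' ℝ}
    {U : Set (ι → ℝ)} (hM : SmoothEntriesOn M U) (hU : IsOpen U) (i : ι) :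
    SmoothEntriesOn (partialDerivMatrix i M) U :=
  fun a b => ((hM a b).fderiv_of_isOpen hU (by simp)).clm_apply contDiffOn_const

theorem partialDerivMatrix_mul [Fintype ι] [DecidableEq ι] [Fintype κ']
    {M : (ι → ℝ) → Matrix κ κ' ℝ} {N : (ι → ℝ) → Matrix κ' κ'' ℝ} {U : Set (ι → ℝ)}
    (hM : SmoothEntriesOn M U) (hN : SmoothEntriesOn N U) (hU : IsOpen U) {p : ι → ℝ} (hp : p ∈ U)
    (i : ι) :
    partialDerivMatrix i (fun q => M q * N q) p =
      partialDerivMatrix i M p * N p + M p * partialDerivMatrix i N p := by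
  ext a b
  exact partialDeriv_sum_mul (fun c => hM.differentiableAt hU hp a c)
    (fun c => hN.differentiableAt hU hp c b) i

end SmoothEntriesOn

end MatrixFields

section ConnectionMatrices

variable {ι : Type} [Fintype ι] [DecidableEq ι]

/-- The matrix `Γ_i = (Γ^k_ij)_kj` of the covariant derivative `∇_i` in the coordinate frame. -/
noncomputable def connectionMatrix (g : MetricField ι) (i : ι) (p : ι → ℝ) : Matrix ι ι ℝ :=
  Matrix.of fun k j => christoffel g k i j p

/-- The matrix `(2 Γ_lij)_lj` of twice the Christoffel symbols of the first kind. -/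
noncomputable def firstKindMatrix (g : MetricField ι) (i : ι) (p : ι → ℝ) : Matrix ι ι ℝ :=
  Matrix.of fun l j => partialDerivMatrix i g p j l + partialDerivMatrix j g p i l
    - partialDerivMatrix l g p i j

/-- The matrix `(R^l_ijk)_lk` of the curvature endomorphism `R(∂_i, ∂_j)`. -/
noncomputable def curvatureMatrix (g : MetricField ι) (i j : ι) (p : ι → ℝ) : Matrix ι ι ℝ :=
  Matrix.of fun l k => curvatureEndo g l i j k p

theorem connectionMatrix_eq_inv_mul_firstKindMatrix (g : MetricField ι) (i : ι) (p : ι → ℝ) :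
    connectionMatrix g i p = (1 / 2 : ℝ) • ((g p)⁻¹ * firstKindMatrix g i p) :=
  rfl

theorem curvatureMatrix_eq_add_commutator (g : MetricField ι) (i j : ι) (p : ι → ℝ) :
    curvatureMatrix g i j p =
      partialDerivMatrix i (connectionMatrix g j) p - partialDerivMatrix j (connectionMatrix g i) p
        + (connectionMatrix g i p * connectionMatrix g j p
          - connectionMatrix g j p * connectionMatrix g i p) := by
  ext l k
  simp only [curvatureMatrix, curvatureEndo, Finset.sum_sub_distrib]
  rfl

theorem curvatureMatrix_swap (g : MetricField ι) (i j : ι) (p : ι → ℝ) :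
    curvatureMatrix g j i p = -curvatureMatrix g i j p := by
  rw [curvatureMatrix_eq_add_commutator, curvatureMatrix_eq_add_commutator]
  abel

theorem christoffel_comm {g : MetricField ι} {U : Set (ι → ℝ)} (hU : IsOpen U)
    (hg : ∀ q ∈ U, (g q).IsSymm) {p : ι → ℝ} (hp : p ∈ U) (k i j : ι) :
    christoffel g k i j p = christoffel g k j i p := by
  have hsymm : ∀ l, partialDeriv l (fun q => g q i j) p = partialDeriv l (fun q => g q j i) p :=
    fun l => (isSymm_partialDerivMatrix hU hg l hp).apply j i
  simp only [christoffel, hsymm, add_comm (partialDeriv i _ p)]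

end ConnectionMatrices

section Riccati

variable {ι κ : Type} [Fintype ι] [DecidableEq ι] [Fintype κ] [DecidableEq κ]

/-- `S` is a smooth field of nondegenerate symmetric matrices on `U`. -/
structure IsNondegenerateOn (S : (ι → ℝ) → Matrix κ κ ℝ) (U : Set (ι → ℝ)) : Prop where
  smooth : SmoothEntriesOn S U
  isSymm : ∀ p ∈ U, (S p).IsSymm
  isUnit_det : ∀ p ∈ U, IsUnit (S p).det

/-- The shape operator `A = ½ S⁻¹ ∂_a S`. If `S` is the metric induced on the level sets of a
coordinate `x^a` with unit gradient, then `A` is the covariant derivative of `∂_a`. -/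
noncomputable def shapeOp (a : ι) (S : (ι → ℝ) → Matrix κ κ ℝ) (p : ι → ℝ) : Matrix κ κ ℝ :=
  (1 / 2 : ℝ) • ((S p)⁻¹ * partialDerivMatrix a S p)

/-- The tidal operator `K = ∂_a A + A²`, the right-hand side of the Riccati equation
`R(∂_a, ·) ∂_a = ∂_a A + A²` for the shape operator `A`. -/
noncomputable def tidalOp (a : ι) (S : (ι → ℝ) → Matrix κ κ ℝ) (p : ι → ℝ) : Matrix κ κ ℝ :=
  partialDerivMatrix a (shapeOp a S) p + shapeOp a S p * shapeOp a S p

/-- The tidal operator with its upper index lowered by `S`. -/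
noncomputable def tidalForm (a : ι) (S : (ι → ℝ) → Matrix κ κ ℝ) (p : ι → ℝ) : Matrix κ κ ℝ :=
  S p * tidalOp a S p

/-- The covariant derivative `∂_a E - Aᵀ E - E A` of the tidal form `E` along `∂_a`. -/
noncomputable def covDerivTidalForm (a : ι) (S : (ι → ℝ) → Matrix κ κ ℝ) (p : ι → ℝ) :
    Matrix κ κ ℝ :=
  partialDerivMatrix a (tidalForm a S) p - (shapeOp a S p).transpose * tidalForm a S p
    - tidalForm a S p * shapeOp a S p

namespace IsNondegenerateOn

variable {S : (ι → ℝ) → Matrix κ κ ℝ} {U : Set (ι → ℝ)} {p : ι → ℝ}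

theorem isSymm_partialDerivMatrix (hS : IsNondegenerateOn S U) (hU : IsOpen U) (hp : p ∈ U)
    (a : ι) : (partialDerivMatrix a S p).IsSymm :=
  _root_.isSymm_partialDerivMatrix hU hS.isSymm a hp

theorem smooth_shapeOp (hS : IsNondegenerateOn S U) (hU : IsOpen U) (a : ι) :
    SmoothEntriesOn (shapeOp a S) U :=
  ((hS.smooth.inv hS.isUnit_det).mul (hS.smooth.partialDerivMatrix hU a)).const_smul _

theorem smooth_tidalOp (hS : IsNondegenerateOn S U) (hU : IsOpen U) (a : ι) :
    SmoothEntriesOn (tidalOp a S) U :=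
  ((hS.smooth_shapeOp hU a).partialDerivMatrix hU a).add
    ((hS.smooth_shapeOp hU a).mul (hS.smooth_shapeOp hU a))

theorem smooth_tidalForm (hS : IsNondegenerateOn S U) (hU : IsOpen U) (a : ι) :
    SmoothEntriesOn (tidalForm a S) U :=
  hS.smooth.mul (hS.smooth_tidalOp hU a)

theorem mul_shapeOp (hS : IsNondegenerateOn S U) (hp : p ∈ U) (a : ι) :
    S p * shapeOp a S p = (1 / 2 : ℝ) • partialDerivMatrix a S p := by
  rw [shapeOp, Matrix.mul_smul, Matrix.mul_nonsing_inv_cancel_left _ _ (hS.isUnit_det p hp)]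

theorem isSymm_partialDerivMatrix_mul_shapeOp (hS : IsNondegenerateOn S U) (hU : IsOpen U)
    (hp : p ∈ U) (a : ι) : (partialDerivMatrix a S p * shapeOp a S p).IsSymm := by
  have hdS := hS.isSymm_partialDerivMatrix hU hp a
  simp only [Matrix.IsSymm, shapeOp, Matrix.transpose_mul, Matrix.transpose_smul,
    Matrix.transpose_nonsing_inv, (hS.isSymm p hp).eq, hdS.eq, Matrix.mul_smul,
    Matrix.mul_assoc]

-- Differentiating `S A = ½ ∂S` gives `S ∂A = ½ ∂∂S - ∂S A`, and `S A² = ½ ∂S A`.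
theorem tidalForm_eq (hS : IsNondegenerateOn S U) (hU : IsOpen U) (hp : p ∈ U) (a : ι) :
    tidalForm a S p = (1 / 2 : ℝ) • partialDerivMatrix a (partialDerivMatrix a S) p
      - (1 / 2 : ℝ) • (partialDerivMatrix a S p * shapeOp a S p) := by
  have hderiv : partialDerivMatrix a S p * shapeOp a S p
      + S p * partialDerivMatrix a (shapeOp a S) p
        = (1 / 2 : ℝ) • partialDerivMatrix a (partialDerivMatrix a S) p := by
    rw [← hS.smooth.partialDerivMatrix_mul (hS.smooth_shapeOp hU a) hU hp,
      partialDerivMatrix_congr_of_isOpen hU (fun q hq => hS.mul_shapeOp hq a) hp,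
      partialDerivMatrix_const_smul]
  rw [tidalForm, tidalOp, Matrix.mul_add, ← Matrix.mul_assoc, hS.mul_shapeOp hp, ← hderiv,
    Matrix.smul_mul]
  module

theorem isSymm_tidalForm (hS : IsNondegenerateOn S U) (hU : IsOpen U) (hp : p ∈ U) (a : ι) :
    (tidalForm a S p).IsSymm := by
  rw [hS.tidalForm_eq hU hp]
  have hsymm : ∀ q ∈ U, (partialDerivMatrix a S q).IsSymm :=
    fun q hq => hS.isSymm_partialDerivMatrix hU hq a
  exact ((_root_.isSymm_partialDerivMatrix hU hsymm a hp).smul _).sub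
    ((hS.isSymm_partialDerivMatrix_mul_shapeOp hU hp a).smul _)

end IsNondegenerateOn

end Riccati

section GeodesicCoordinates

variable {ι : Type}

/-- The components `g_aj` are constant on `U`; the integral curves of `∂_a` are then geodesics. -/
def HasConstantRowOn (g : MetricField ι) (a : ι) (U : Set (ι → ℝ)) : Prop :=
  ∃ c : ι → ℝ, ∀ p ∈ U, g p a = c

namespace HasConstantRowOn

variable {g : MetricField ι} {a : ι} {U : Set (ι → ℝ)} {p : ι → ℝ}

theorem partialDerivMatrix_row [DecidableEq ι] (hrow : HasConstantRowOn g a U) (hU : IsOpen U)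
    (hp : p ∈ U) (i : ι) : partialDerivMatrix i g p a = 0 := by
  obtain ⟨c, hc⟩ := hrow
  ext j
  rw [partialDerivMatrix_apply,
    partialDeriv_congr_of_isOpen hU (fun q hq => congrFun (hc q hq) j) hp, partialDeriv_const]
  rfl

variable [Fintype ι] [DecidableEq ι]
variable (hrow : HasConstantRowOn g a U) (hg : IsNondegenerateOn g U) (hU : IsOpen U) (hp : p ∈ U)

include hrow hg hU hp

theorem shapeOp_col (k : ι) : shapeOp a g p k a = 0 := by
  have hcol : ∀ l, partialDerivMatrix a g p l a = 0 := fun l => by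
    rw [← (hg.isSymm_partialDerivMatrix hU hp a).apply, hrow.partialDerivMatrix_row hU hp]
    rfl
  simp only [shapeOp, Matrix.smul_apply, Matrix.mul_apply, hcol, mul_zero, Finset.sum_const_zero,
    smul_zero]

theorem connectionMatrix_eq_shapeOp : connectionMatrix g a p = shapeOp a g p := by
  have hfirst : firstKindMatrix g a p = partialDerivMatrix a g p := by
    ext l j
    have hrow' := hrow.partialDerivMatrix_row hU hp
    rw [firstKindMatrix, Matrix.of_apply, hrow', hrow', Pi.zero_apply, Pi.zero_apply, add_zero,
      sub_zero, (hg.isSymm_partialDerivMatrix hU hp a).apply]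
  rw [connectionMatrix_eq_inv_mul_firstKindMatrix, hfirst, shapeOp]

theorem christoffel_eq_shapeOp (k i : ι) : christoffel g k a i p = shapeOp a g p k i :=
  congrFun₂ (hrow.connectionMatrix_eq_shapeOp hg hU hp) k i

theorem curvatureEndo_eq_tidalOp (l j : ι) : curvatureEndo g l a j a p = tidalOp a g p l j := by
  have hΓ : ∀ q ∈ U, ∀ k i, christoffel g k i a q = shapeOp a g q k i := fun q hq k i => by
    rw [christoffel_comm hU hg.isSymm hq, hrow.christoffel_eq_shapeOp hg hU hq]
  have hΓcol : ∀ q ∈ U, ∀ k, christoffel g k a a q = 0 := fun q hq k => by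
    rw [hΓ q hq, hrow.shapeOp_col hg hU hq]
  rw [curvatureEndo, partialDeriv_congr_of_isOpen hU (fun q hq => hΓ q hq l j) hp,
    partialDeriv_congr_of_isOpen hU (fun q hq => hΓcol q hq l) hp, partialDeriv_const]
  simp only [hΓcol p hp, hΓ p hp, hrow.christoffel_eq_shapeOp hg hU hp, mul_zero, sub_zero]
  rfl

theorem ricci_eq_neg_trace_tidalOp : ricci g a a p = -(tidalOp a g p).trace := by
  have hswap : ∀ b, curvatureEndo g b b a a p = -curvatureEndo g b a b a p :=
    fun b => congrFun₂ (curvatureMatrix_swap g a b p) b a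
  simp only [ricci, hswap, hrow.curvatureEndo_eq_tidalOp hg hU hp, Finset.sum_neg_distrib]
  rfl

theorem riemannTensor_eq_tidalForm (j l : ι) : riemannTensor g a j a l p = tidalForm a g p j l := by
  simp only [riemannTensor, hrow.curvatureEndo_eq_tidalOp hg hU hp]
  rw [← (hg.isSymm_tidalForm hU hp a).apply, tidalForm, Matrix.mul_apply]
  exact Finset.sum_congr rfl fun b _ => by rw [mul_comm, (hg.isSymm p hp).apply]

theorem covDerivRicci_eq :
    covDerivRicci g a a a p = -partialDeriv a (fun q => (tidalOp a g q).trace) p := by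
  have hderiv : partialDeriv a (ricci g a a) p
      = -1 * partialDeriv a (fun q => (tidalOp a g q).trace) p := by
    rw [← partialDeriv_const_mul]
    exact partialDeriv_congr_of_isOpen hU
      (fun q hq => by rw [hrow.ricci_eq_neg_trace_tidalOp hg hU hq, neg_one_mul]) hp a
  simp only [covDerivRicci, hderiv, hrow.christoffel_eq_shapeOp hg hU hp,
    hrow.shapeOp_col hg hU hp, zero_mul, Finset.sum_const_zero, sub_zero, neg_one_mul]

theorem covDerivRiemann_eq_covDerivTidalForm (j l : ι) :
    covDerivRiemann g a a j a l p = covDerivTidalForm a g p j l := by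
  have hderiv : partialDeriv a (riemannTensor g a j a l) p
      = partialDerivMatrix a (tidalForm a g) p j l :=
    partialDeriv_congr_of_isOpen hU
      (fun q hq => hrow.riemannTensor_eq_tidalForm hg hU hq j l) hp a
  simp only [covDerivRiemann, hderiv, hrow.christoffel_eq_shapeOp hg hU hp,
    hrow.shapeOp_col hg hU hp, hrow.riemannTensor_eq_tidalForm hg hU hp, zero_mul,
    Finset.sum_const_zero, sub_zero, covDerivTidalForm, Matrix.sub_apply, Matrix.mul_apply,
    Matrix.transpose_apply, mul_comm (shapeOp a g p _ l)]

end HasConstantRowOn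

end GeodesicCoordinates

section KulkarniNomizu

variable {ι : Type}

/-- The Kulkarni–Nomizu product of two matrices, regarded as bilinear forms. -/
def kulkarniNomizu (M N : Matrix ι ι ℝ) (i j k l : ι) : ℝ :=
  M i k * N j l + M j l * N i k - M i l * N j k - M j k * N i l

theorem kulkarniNomizu_vecMulVec_add_symm (v w : ι → ℝ) (i j k l : ι) :
    kulkarniNomizu (Matrix.vecMulVec v v) (Matrix.vecMulVec v w + Matrix.vecMulVec w v) i j k l
      = 0 := by
  simp only [kulkarniNomizu, Matrix.add_apply, Matrix.vecMulVec_apply]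
  ring

theorem kulkarniNomizu_zero_left (N : Matrix ι ι ℝ) (i j k l : ι) :
    kulkarniNomizu 0 N i j k l = 0 := by
  simp only [kulkarniNomizu, Matrix.zero_apply, zero_mul, add_zero, sub_zero]

theorem kulkarniNomizu_zero_right (M : Matrix ι ι ℝ) (i j k l : ι) :
    kulkarniNomizu M 0 i j k l = 0 := by
  simp only [kulkarniNomizu, Matrix.zero_apply, mul_zero, add_zero, sub_zero]

theorem kulkarniNomizu_sub (M N N' : Matrix ι ι ℝ) (i j k l : ι) :
    kulkarniNomizu M (N - N') i j k l =
      kulkarniNomizu M N i j k l - kulkarniNomizu M N' i j k l := by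
  simp only [kulkarniNomizu, Matrix.sub_apply]
  ring

theorem kulkarniNomizu_smul (c : ℝ) (M N : Matrix ι ι ℝ) (i j k l : ι) :
    kulkarniNomizu M (c • N) i j k l = c * kulkarniNomizu M N i j k l := by
  simp only [kulkarniNomizu, Matrix.smul_apply, smul_eq_mul]
  ring

theorem kulkarniNomizu_derivation [Fintype ι] (Γ M N : Matrix ι ι ℝ) (i j k l : ι) :
    ∑ d, Γ d i * kulkarniNomizu M N d j k l + ∑ d, Γ d j * kulkarniNomizu M N i d k l
        + ∑ d, Γ d k * kulkarniNomizu M N i j d l + ∑ d, Γ d l * kulkarniNomizu M N i j k d =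
      kulkarniNomizu (Γ.transpose * M + M * Γ) N i j k l
        + kulkarniNomizu M (Γ.transpose * N + N * Γ) i j k l := by
  simp only [kulkarniNomizu, Matrix.add_apply, Matrix.mul_apply, Matrix.transpose_apply,
    ← Finset.sum_add_distrib, ← Finset.sum_sub_distrib, Finset.sum_mul, Finset.mul_sum]
  exact Finset.sum_congr rfl fun d _ => by ring

theorem partialDeriv_kulkarniNomizu {κ : Type} [Finite κ] [DecidableEq κ] {M : Matrix ι ι ℝ}
    {N : (κ → ℝ) → Matrix ι ι ℝ} {p : κ → ℝ}
    (hN : ∀ i j, DifferentiableAt ℝ (fun q => N q i j) p) (c : κ) (i j k l : ι) :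
    partialDeriv c (fun q => kulkarniNomizu M (N q) i j k l) p =
      kulkarniNomizu M (partialDerivMatrix c N p) i j k l := by
  have := Fintype.ofFinite κ
  simp only [kulkarniNomizu]
  rw [partialDeriv_sub ((((hN j l).const_mul _).fun_add ((hN i k).const_mul _)).fun_sub
      ((hN j k).const_mul _)) ((hN i l).const_mul _),
    partialDeriv_sub (((hN j l).const_mul _).fun_add ((hN i k).const_mul _))
      ((hN j k).const_mul _),
    partialDeriv_add ((hN j l).const_mul _) ((hN i k).const_mul _)]
  simp only [partialDeriv_const_mul, partialDerivMatrix_apply]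

end KulkarniNomizu

section PlaneWaves

variable {ι κ κ' : Type} [DecidableEq ι]

/-- The components `δ^i_a` of the coordinate vector field `∂_a` and of the one-form `dx^a`. -/
abbrev coordVec (a : ι) : ι → ℝ := Pi.single a 1

section DependsOn

variable {a : ι}

theorem partialDeriv_of_dependsOn [Finite ι] {f : (ι → ℝ) → ℝ} (hf : DependsOn f {a}) (i : ι)
    (p : ι → ℝ) : partialDeriv i f p = coordVec a i * partialDeriv a f p := by
  have := Fintype.ofFinite ι
  obtain rfl | hia := eq_or_ne i a
  · rw [coordVec, Pi.single_eq_same, one_mul]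
  rw [coordVec, Pi.single_eq_of_ne hia, zero_mul, partialDeriv]
  by_cases hdiff : DifferentiableAt ℝ f p
  · have hconst : (fun t : ℝ => f (p + t • Pi.single i 1)) = fun _ => f p :=
      funext fun t => hf fun j hj => by simp [Set.mem_singleton_iff.1 hj, hia.symm]
    rw [← hdiff.lineDeriv_eq_fderiv, lineDeriv, hconst, deriv_const]
  · rw [fderiv_zero_of_not_differentiableAt hdiff, zero_apply]

theorem partialDerivMatrix_of_dependsOn [Finite ι] {M : (ι → ℝ) → Matrix κ κ' ℝ}
    (hM : DependsOn M {a}) (i : ι) (p : ι → ℝ) :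
    partialDerivMatrix i M p = coordVec a i • partialDerivMatrix a M p := by
  ext k l
  exact partialDeriv_of_dependsOn (fun _ _ h => congrFun₂ (hM h) k l) i p

theorem dependsOn_partialDeriv [Finite ι] {f : (ι → ℝ) → ℝ} (hf : DependsOn f {a}) (i : ι) :
    DependsOn (partialDeriv i f) {a} := by
  have := Fintype.ofFinite ι
  intro p q hpq
  have htranslate : (fun x => f (x + (q - p))) = f :=
    funext fun x => hf fun j hj => by simp [hpq j hj]
  rw [partialDeriv, ← htranslate, fderiv_comp_add_right, add_sub_cancel, htranslate, partialDeriv]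

theorem dependsOn_partialDerivMatrix [Finite ι] {M : (ι → ℝ) → Matrix κ κ' ℝ}
    (hM : DependsOn M {a}) (i : ι) : DependsOn (partialDerivMatrix i M) {a} := by
  intro p q hpq
  ext k l
  exact dependsOn_partialDeriv (fun _ _ h => congrFun₂ (hM h) k l) i hpq

variable [Finite ι] [Fintype κ] [DecidableEq κ] {S : (ι → ℝ) → Matrix κ κ ℝ}

theorem dependsOn_shapeOp (hS : DependsOn S {a}) (i : ι) : DependsOn (shapeOp i S) {a} :=
  fun p q hpq => by rw [shapeOp, shapeOp, hS hpq, dependsOn_partialDerivMatrix hS i hpq]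

theorem dependsOn_tidalOp (hS : DependsOn S {a}) (i : ι) : DependsOn (tidalOp i S) {a} :=
  fun p q hpq => by
    rw [tidalOp, tidalOp, dependsOn_shapeOp hS i hpq,
      dependsOn_partialDerivMatrix (dependsOn_shapeOp hS i) i hpq]

theorem dependsOn_tidalForm (hS : DependsOn S {a}) (i : ι) : DependsOn (tidalForm i S) {a} :=
  fun p q hpq => by rw [tidalForm, tidalForm, hS hpq, dependsOn_tidalOp hS i hpq]

end DependsOn

variable [Fintype ι]

/-- `h` is a plane wave metric on `U` in Rosen coordinates: its components depend only on the
coordinate `x^a`, and `∂_b` is a null vector field with `h(∂_b, ·) = dx^a`. -/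
structure IsRosenOn (h : MetricField ι) (a b : ι) (U : Set (ι → ℝ)) : Prop where
  nondegenerate : IsNondegenerateOn h U
  dependsOn : DependsOn h {a}
  row_eq : ∀ p ∈ U, h p b = coordVec a
  ne : a ≠ b

namespace IsRosenOn

variable {h : MetricField ι} {a b : ι} {U : Set (ι → ℝ)} {p : ι → ℝ}

theorem hasConstantRowOn (hh : IsRosenOn h a b U) : HasConstantRowOn h b U :=
  ⟨_, hh.row_eq⟩

theorem inv_mulVec_coordVec (hh : IsRosenOn h a b U) (hp : p ∈ U) :
    (h p)⁻¹.mulVec (coordVec a) = coordVec b := by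
  have hcol : (h p).mulVec (coordVec b) = coordVec a := by
    rw [← Matrix.vecMul_transpose, hh.nondegenerate.isSymm p hp, Matrix.single_one_vecMul]
    exact hh.row_eq p hp
  rw [← hcol, Matrix.mulVec_mulVec, Matrix.nonsing_inv_mul _ (hh.nondegenerate.isUnit_det p hp),
    Matrix.one_mulVec]

theorem coordVec_vecMul_inv (hh : IsRosenOn h a b U) (hp : p ∈ U) :
    Matrix.vecMul (coordVec a) (h p)⁻¹ = coordVec b := by
  rw [← hh.inv_mulVec_coordVec hp, ← Matrix.mulVec_transpose, Matrix.transpose_nonsing_inv,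
    hh.nondegenerate.isSymm p hp]

theorem coordVec_vecMul_partialDerivMatrix (hh : IsRosenOn h a b U) (hU : IsOpen U) (hp : p ∈ U)
    (i : ι) : Matrix.vecMul (coordVec b) (partialDerivMatrix i h p) = 0 := by
  rw [Matrix.single_one_vecMul]
  exact hh.hasConstantRowOn.partialDerivMatrix_row hU hp i

theorem coordVec_vecMul_shapeOp (hh : IsRosenOn h a b U) (hU : IsOpen U) (hp : p ∈ U) :
    Matrix.vecMul (coordVec a) (shapeOp a h p) = 0 := by
  rw [shapeOp, Matrix.vecMul_smul, ← Matrix.vecMul_vecMul, hh.coordVec_vecMul_inv hp,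
    hh.coordVec_vecMul_partialDerivMatrix hU hp, smul_zero]

theorem partialDerivMatrix_mulVec_coordVec (hh : IsRosenOn h a b U) (hU : IsOpen U) (hp : p ∈ U)
    (i : ι) : (partialDerivMatrix i h p).mulVec (coordVec b) = 0 := by
  rw [← Matrix.vecMul_transpose, hh.nondegenerate.isSymm_partialDerivMatrix hU hp,
    hh.coordVec_vecMul_partialDerivMatrix hU hp]

theorem shapeOp_mulVec_coordVec (hh : IsRosenOn h a b U) (hU : IsOpen U) (hp : p ∈ U) :
    (shapeOp a h p).mulVec (coordVec b) = 0 := by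
  rw [shapeOp, Matrix.smul_mulVec, ← Matrix.mulVec_mulVec,
    hh.partialDerivMatrix_mulVec_coordVec hU hp, Matrix.mulVec_zero, smul_zero]

theorem connectionMatrix_eq (hh : IsRosenOn h a b U) (hU : IsOpen U) (hp : p ∈ U) (i : ι) :
    connectionMatrix h i p = coordVec a i • shapeOp a h p
      + Matrix.vecMulVec ((shapeOp a h p).transpose i) (coordVec a)
      - Matrix.vecMulVec (coordVec b) ((1 / 2 : ℝ) • partialDerivMatrix a h p i) := by
  set D := partialDerivMatrix a h p with hD
  have hDsymm : D.IsSymm := hh.nondegenerate.isSymm_partialDerivMatrix hU hp a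
  have hderiv (j : ι) : partialDerivMatrix j h p = coordVec a j • D :=
    partialDerivMatrix_of_dependsOn hh.dependsOn j p
  have hfirst : firstKindMatrix h i p = coordVec a i • D
      + Matrix.vecMulVec (D i) (coordVec a) - Matrix.vecMulVec (coordVec a) (D i) := by
    ext l j
    simp only [firstKindMatrix, hderiv, Matrix.of_apply, Matrix.sub_apply, Matrix.add_apply,
      Matrix.smul_apply, Matrix.vecMulVec_apply, smul_eq_mul]
    linear_combination coordVec a i * hDsymm.apply l j
  have hA : (1 / 2 : ℝ) • (h p)⁻¹.mulVec (D i) = (shapeOp a h p).transpose i := by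
    ext k
    simp only [shapeOp, ← hD, Matrix.transpose_apply, Matrix.smul_apply, Matrix.mul_apply,
      hDsymm.apply i]
    rfl
  rw [connectionMatrix_eq_inv_mul_firstKindMatrix, hfirst, Matrix.mul_sub, Matrix.mul_add,
    Matrix.mul_vecMulVec, Matrix.mul_vecMulVec, hh.inv_mulVec_coordVec hp, Matrix.mul_smul, ← hA,
    Matrix.smul_vecMulVec, Matrix.vecMulVec_smul, shapeOp, ← hD]
  module

theorem coordVec_dotProduct (hh : IsRosenOn h a b U) : coordVec a ⬝ᵥ coordVec b = 0 := by
  rw [single_one_dotProduct, coordVec, Pi.single_eq_of_ne hh.ne]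

theorem partialDerivMatrix_connectionMatrix (hh : IsRosenOn h a b U) (hU : IsOpen U) (hp : p ∈ U)
    (i j : ι) :
    partialDerivMatrix i (connectionMatrix h j) p = coordVec a i •
      (coordVec a j • partialDerivMatrix a (shapeOp a h) p
        + Matrix.vecMulVec ((partialDerivMatrix a (shapeOp a h) p).transpose j) (coordVec a)
        - Matrix.vecMulVec (coordVec b)
            ((1 / 2 : ℝ) • partialDerivMatrix a (partialDerivMatrix a h) p j)) := by
  have hA := (hh.nondegenerate.smooth_shapeOp hU a).differentiableAt hU hp
  have hD := (hh.nondegenerate.smooth.partialDerivMatrix hU a).differentiableAt hU hp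
  have hdA (k l : ι) := partialDeriv_of_dependsOn
    (fun _ _ hq => congrFun₂ (dependsOn_shapeOp hh.dependsOn a hq) k l) i p
  have hdD (k l : ι) := partialDeriv_of_dependsOn
    (fun _ _ hq => congrFun₂ (dependsOn_partialDerivMatrix hh.dependsOn a hq) k l) i p
  rw [partialDerivMatrix_congr_of_isOpen hU (fun q hq => hh.connectionMatrix_eq hU hq j) hp]
  ext k l
  have hentry : partialDerivMatrix i (fun q => coordVec a j • shapeOp a h q
      + Matrix.vecMulVec ((shapeOp a h q).transpose j) (coordVec a)
      - Matrix.vecMulVec (coordVec b) ((1 / 2 : ℝ) • partialDerivMatrix a h q j)) p k l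
    = partialDeriv i (fun q => coordVec a j * shapeOp a h q k l
        + coordVec a l * shapeOp a h q k j
        - (coordVec b k * (1 / 2)) * partialDerivMatrix a h q j l) p := by
    simp only [partialDerivMatrix_apply, Matrix.sub_apply, Matrix.add_apply, Matrix.smul_apply,
      Matrix.vecMulVec_apply, Matrix.transpose_apply, Pi.smul_apply, smul_eq_mul, mul_assoc,
      mul_comm (coordVec a l)]
  rw [hentry, partialDeriv_sub (((hA k l).const_mul _).fun_add ((hA k j).const_mul _))
    ((hD j l).const_mul _), partialDeriv_add ((hA k l).const_mul _) ((hA k j).const_mul _),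
    partialDeriv_const_mul, partialDeriv_const_mul, partialDeriv_const_mul, hdA, hdA, hdD]
  simp only [partialDerivMatrix_apply, Matrix.sub_apply, Matrix.add_apply, Matrix.smul_apply,
    Matrix.vecMulVec_apply, Matrix.transpose_apply, Pi.smul_apply, smul_eq_mul]
  ring

theorem connectionMatrix_mul (hh : IsRosenOn h a b U) (hU : IsOpen U) (hp : p ∈ U) (i j : ι) :
    connectionMatrix h i p * connectionMatrix h j p =
      coordVec a i • (coordVec a j • (shapeOp a h p * shapeOp a h p)
        + Matrix.vecMulVec ((shapeOp a h p * shapeOp a h p).transpose j) (coordVec a))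
      - coordVec a j • Matrix.vecMulVec (coordVec b)
          ((1 / 2 : ℝ) • (partialDerivMatrix a h p * shapeOp a h p) i)
      - ((1 / 2 : ℝ) * (partialDerivMatrix a h p * shapeOp a h p) i j) •
          Matrix.vecMulVec (coordVec b) (coordVec a) := by
  have hA : coordVec a ⬝ᵥ (shapeOp a h p).transpose j = 0 :=
    congrFun (hh.coordVec_vecMul_shapeOp hU hp) j
  have hD : partialDerivMatrix a h p i ⬝ᵥ coordVec b = 0 :=
    congrFun (hh.partialDerivMatrix_mulVec_coordVec hU hp a) i
  have hAA : (shapeOp a h p).mulVec ((shapeOp a h p).transpose j) =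
    (shapeOp a h p * shapeOp a h p).transpose j := rfl
  have hDA_row : Matrix.vecMul (partialDerivMatrix a h p i) (shapeOp a h p) =
    (partialDerivMatrix a h p * shapeOp a h p) i := rfl
  have hDA : partialDerivMatrix a h p i ⬝ᵥ (shapeOp a h p).transpose j =
    (partialDerivMatrix a h p * shapeOp a h p) i j := rfl
  rw [hh.connectionMatrix_eq hU hp, hh.connectionMatrix_eq hU hp]
  simp only [Matrix.mul_sub, Matrix.mul_add, Matrix.sub_mul, Matrix.add_mul, Matrix.smul_mul,
    Matrix.mul_smul, Matrix.vecMulVec_mul_vecMulVec, Matrix.vecMulVec_smul, hA, hD, hDA,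
    hh.coordVec_dotProduct, zero_smul, smul_zero, Matrix.vecMulVec_zero]
  simp only [Matrix.mul_vecMulVec, Matrix.vecMulVec_mul,
    hh.shapeOp_mulVec_coordVec hU hp, hh.coordVec_vecMul_shapeOp hU hp, hAA, hDA_row,
    Matrix.zero_vecMulVec, Matrix.vecMulVec_zero, smul_zero]
  module

theorem curvatureMatrix_eq (hh : IsRosenOn h a b U) (hU : IsOpen U) (hp : p ∈ U) (i j : ι) :
    curvatureMatrix h i j p =
      coordVec a i • (Matrix.vecMulVec ((tidalOp a h p).transpose j) (coordVec a)
        - Matrix.vecMulVec (coordVec b) (tidalForm a h p j))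
      - coordVec a j • (Matrix.vecMulVec ((tidalOp a h p).transpose i) (coordVec a)
        - Matrix.vecMulVec (coordVec b) (tidalForm a h p i)) := by
  have hsymm := (hh.nondegenerate.isSymm_partialDerivMatrix_mul_shapeOp hU hp a).apply i j
  have hK (k : ι) : (tidalOp a h p).transpose k =
      (partialDerivMatrix a (shapeOp a h) p).transpose k
        + (shapeOp a h p * shapeOp a h p).transpose k := rfl
  have hE (k : ι) : tidalForm a h p k =
      (1 / 2 : ℝ) • partialDerivMatrix a (partialDerivMatrix a h) p k
        - (1 / 2 : ℝ) • (partialDerivMatrix a h p * shapeOp a h p) k := by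
    rw [hh.nondegenerate.tidalForm_eq hU hp]
    rfl
  rw [curvatureMatrix_eq_add_commutator, hh.partialDerivMatrix_connectionMatrix hU hp,
    hh.partialDerivMatrix_connectionMatrix hU hp, hh.connectionMatrix_mul hU hp,
    hh.connectionMatrix_mul hU hp, hsymm, hK, hK, hE, hE]
  simp only [Matrix.add_vecMulVec, Matrix.vecMulVec_sub]
  module

theorem curvatureEndo_eq (hh : IsRosenOn h a b U) (hU : IsOpen U) (hp : p ∈ U) (l i j k : ι) :
    curvatureEndo h l i j k p =
      coordVec a i * (tidalOp a h p l j * coordVec a k - coordVec b l * tidalForm a h p j k)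
      - coordVec a j * (tidalOp a h p l i * coordVec a k - coordVec b l * tidalForm a h p i k) :=
  congrFun₂ (hh.curvatureMatrix_eq hU hp i j) l k

theorem riemannTensor_eq (hh : IsRosenOn h a b U) (hU : IsOpen U) (hp : p ∈ U) (i j k l : ι) :
    riemannTensor h i j k l p =
      kulkarniNomizu (Matrix.vecMulVec (coordVec a) (coordVec a)) (tidalForm a h p) i j k l := by
  have hE (j : ι) : ∑ c, tidalOp a h p c j * h p c l = tidalForm a h p j l := by
    rw [← (hh.nondegenerate.isSymm_tidalForm hU hp a).apply, tidalForm, Matrix.mul_apply]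
    exact Finset.sum_congr rfl fun c _ => by
      rw [mul_comm, (hh.nondegenerate.isSymm p hp).apply]
  have hb : ∑ c, coordVec b c * h p c l = coordVec a l :=
    (congrFun (Matrix.single_one_vecMul b (h p)) l).trans (congrFun (hh.row_eq p hp) l)
  calc riemannTensor h i j k l p
      = coordVec a i * (coordVec a k * ∑ c, tidalOp a h p c j * h p c l
            - tidalForm a h p j k * ∑ c, coordVec b c * h p c l)
          - coordVec a j * (coordVec a k * ∑ c, tidalOp a h p c i * h p c l
            - tidalForm a h p i k * ∑ c, coordVec b c * h p c l) := by
        simp only [riemannTensor, hh.curvatureEndo_eq hU hp, Finset.mul_sum,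
          ← Finset.sum_sub_distrib]
        exact Finset.sum_congr rfl fun c _ => by ring
    _ = _ := by
        simp only [hE, hb, kulkarniNomizu, Matrix.vecMulVec_apply]
        ring

theorem coordVec_vecMul_tidalOp (hh : IsRosenOn h a b U) (hU : IsOpen U) (hp : p ∈ U) :
    Matrix.vecMul (coordVec a) (tidalOp a h p) = 0 := by
  have hA : ∀ q ∈ U, ∀ j, shapeOp a h q a j = 0 := fun q hq =>
    congrFun ((Matrix.single_one_vecMul a _).symm.trans (hh.coordVec_vecMul_shapeOp hU hq))
  rw [tidalOp, Matrix.vecMul_add, ← Matrix.vecMul_vecMul, hh.coordVec_vecMul_shapeOp hU hp,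
    Matrix.zero_vecMul, add_zero, Matrix.single_one_vecMul]
  ext j
  exact (partialDeriv_congr_of_isOpen hU (fun q hq => hA q hq j) hp a).trans
    (partialDeriv_const a 0 p)

theorem tidalForm_row (hh : IsRosenOn h a b U) (hU : IsOpen U) (hp : p ∈ U) :
    tidalForm a h p b = 0 := by
  rw [← hh.coordVec_vecMul_tidalOp hU hp, ← hh.row_eq p hp]
  rfl

theorem ricci_eq (hh : IsRosenOn h a b U) (hU : IsOpen U) (hp : p ∈ U) (i j : ι) :
    ricci h i j p = -(tidalOp a h p).trace * (coordVec a i * coordVec a j) := by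
  have hK : ∑ c, coordVec a c * tidalOp a h p c i = 0 :=
    congrFun (hh.coordVec_vecMul_tidalOp hU hp) i
  have hE : ∑ c, coordVec b c * tidalForm a h p c j = 0 := by
    have hrow := congrFun (Matrix.single_one_vecMul b (tidalForm a h p)) j
    exact hrow.trans (congrFun (hh.tidalForm_row hU hp) j)
  have hnull : ∑ c, coordVec a c * coordVec b c = 0 := hh.coordVec_dotProduct
  calc ricci h i j p
      = coordVec a j * ∑ c, coordVec a c * tidalOp a h p c i
          - tidalForm a h p i j * ∑ c, coordVec a c * coordVec b c
          - coordVec a i * (coordVec a j * (tidalOp a h p).trace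
            - ∑ c, coordVec b c * tidalForm a h p c j) := by
        simp only [ricci, hh.curvatureEndo_eq hU hp, Matrix.trace, Matrix.diag_apply,
          Finset.mul_sum, ← Finset.sum_sub_distrib]
        exact Finset.sum_congr rfl fun c _ => by ring
    _ = _ := by
        rw [hK, hE, hnull]
        ring

theorem coordVec_vecMul_connectionMatrix (hh : IsRosenOn h a b U) (hU : IsOpen U) (hp : p ∈ U)
    (i : ι) : Matrix.vecMul (coordVec a) (connectionMatrix h i p) = 0 := by
  have hA : coordVec a ⬝ᵥ (shapeOp a h p).transpose i = 0 :=
    congrFun (hh.coordVec_vecMul_shapeOp hU hp) i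
  rw [hh.connectionMatrix_eq hU hp, Matrix.vecMul_sub, Matrix.vecMul_add, Matrix.vecMul_smul,
    hh.coordVec_vecMul_shapeOp hU hp, Matrix.vecMul_vecMulVec, Matrix.vecMul_vecMulVec, hA,
    hh.coordVec_dotProduct]
  simp only [zero_smul, smul_zero, add_zero, sub_zero]

theorem tidalForm_mul_connectionMatrix (hh : IsRosenOn h a b U) (hU : IsOpen U) (hp : p ∈ U)
    (i : ι) :
    tidalForm a h p * connectionMatrix h i p =
      coordVec a i • (tidalForm a h p * shapeOp a h p)
        + Matrix.vecMulVec ((tidalForm a h p * shapeOp a h p).transpose i) (coordVec a) := by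
  have hEb : (tidalForm a h p).mulVec (coordVec b) = 0 := by
    rw [← Matrix.vecMul_transpose, hh.nondegenerate.isSymm_tidalForm hU hp,
      Matrix.single_one_vecMul]
    exact hh.tidalForm_row hU hp
  have hEA : (tidalForm a h p).mulVec ((shapeOp a h p).transpose i) =
    (tidalForm a h p * shapeOp a h p).transpose i := rfl
  rw [hh.connectionMatrix_eq hU hp, Matrix.mul_sub, Matrix.mul_add, Matrix.mul_smul,
    Matrix.mul_vecMulVec, Matrix.mul_vecMulVec, hEb, hEA, Matrix.zero_vecMulVec, sub_zero]

theorem covDerivRicci_eq (hh : IsRosenOn h a b U) (hU : IsOpen U) (hp : p ∈ U) (c i j : ι) :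
    covDerivRicci h c i j p = -partialDeriv a (fun q => (tidalOp a h q).trace) p *
      (coordVec a c * coordVec a i * coordVec a j) := by
  have hparallel (k : ι) : ∑ d, coordVec a d * christoffel h d c k p = 0 :=
    congrFun (hh.coordVec_vecMul_connectionMatrix hU hp c) k
  have hderiv : partialDeriv c (ricci h i j) p =
      -(coordVec a i * coordVec a j) *
        (coordVec a c * partialDeriv a (fun q => (tidalOp a h q).trace) p) := by
    rw [← partialDeriv_of_dependsOn
      (fun _ _ hq => congrArg Matrix.trace (dependsOn_tidalOp hh.dependsOn a hq)),
      ← partialDeriv_const_mul]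
    exact partialDeriv_congr_of_isOpen hU (fun q hq => by rw [hh.ricci_eq hU hq]; ring) hp c
  have hfirst : ∑ d, christoffel h d c i p * ricci h d j p = 0 := by
    rw [← mul_zero (-(tidalOp a h p).trace * coordVec a j), ← hparallel i, Finset.mul_sum]
    exact Finset.sum_congr rfl fun d _ => by rw [hh.ricci_eq hU hp]; ring
  have hsecond : ∑ d, christoffel h d c j p * ricci h i d p = 0 := by
    rw [← mul_zero (-(tidalOp a h p).trace * coordVec a i), ← hparallel j, Finset.mul_sum]
    exact Finset.sum_congr rfl fun d _ => by rw [hh.ricci_eq hU hp]; ring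
  rw [covDerivRicci, hfirst, hsecond, hderiv]
  ring

-- The null rotation part of `Γ_c` only contributes a symmetric product with `dx^a`.
theorem smul_partialDerivMatrix_tidalForm_sub (hh : IsRosenOn h a b U) (hU : IsOpen U)
    (hp : p ∈ U) (c : ι) :
    ∃ w : ι → ℝ, coordVec a c • partialDerivMatrix a (tidalForm a h) p
        - ((connectionMatrix h c p).transpose * tidalForm a h p
          + tidalForm a h p * connectionMatrix h c p) =
      coordVec a c • covDerivTidalForm a h p
        - (Matrix.vecMulVec (coordVec a) w + Matrix.vecMulVec w (coordVec a)) := by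
  have hE : (tidalForm a h p).IsSymm := hh.nondegenerate.isSymm_tidalForm hU hp a
  have hadjoint (M : Matrix ι ι ℝ) :
      M.transpose * tidalForm a h p = (tidalForm a h p * M).transpose := by
    rw [Matrix.transpose_mul, hE.eq]
  refine ⟨(tidalForm a h p * shapeOp a h p).transpose c, ?_⟩
  rw [hadjoint, hh.tidalForm_mul_connectionMatrix hU hp, covDerivTidalForm, hadjoint,
    Matrix.transpose_add, Matrix.transpose_smul, Matrix.transpose_vecMulVec]
  module

theorem covDerivRiemann_eq (hh : IsRosenOn h a b U) (hU : IsOpen U) (hp : p ∈ U)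
    (c i j k l : ι) :
    covDerivRiemann h c i j k l p = coordVec a c *
      kulkarniNomizu (Matrix.vecMulVec (coordVec a) (coordVec a)) (covDerivTidalForm a h p)
        i j k l := by
  set M := Matrix.vecMulVec (coordVec a) (coordVec a) with hM
  have hparallel : (connectionMatrix h c p).transpose * M + M * connectionMatrix h c p = 0 := by
    rw [hM, Matrix.mul_vecMulVec, Matrix.vecMulVec_mul, Matrix.mulVec_transpose,
      hh.coordVec_vecMul_connectionMatrix hU hp, Matrix.zero_vecMulVec, Matrix.vecMulVec_zero,
      add_zero]
  have hderiv : partialDeriv c (riemannTensor h i j k l) p =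
      kulkarniNomizu M (coordVec a c • partialDerivMatrix a (tidalForm a h) p) i j k l := by
    rw [partialDeriv_congr_of_isOpen hU (fun q hq => hh.riemannTensor_eq hU hq i j k l) hp,
      partialDeriv_kulkarniNomizu ((hh.nondegenerate.smooth_tidalForm hU a).differentiableAt hU hp),
      partialDerivMatrix_of_dependsOn (dependsOn_tidalForm hh.dependsOn a)]
  have hslots := kulkarniNomizu_derivation (connectionMatrix h c p) M (tidalForm a h p) i j k l
  rw [hparallel, kulkarniNomizu_zero_left, zero_add] at hslots
  obtain ⟨w, hw⟩ := hh.smul_partialDerivMatrix_tidalForm_sub hU hp c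
  calc covDerivRiemann h c i j k l p
      = kulkarniNomizu M (coordVec a c • partialDerivMatrix a (tidalForm a h) p) i j k l
          - kulkarniNomizu M ((connectionMatrix h c p).transpose * tidalForm a h p
              + tidalForm a h p * connectionMatrix h c p) i j k l := by
        rw [← hslots, covDerivRiemann, hderiv]
        simp only [hh.riemannTensor_eq hU hp, sub_sub]
        rfl
    _ = coordVec a c * kulkarniNomizu M (covDerivTidalForm a h p) i j k l := by
        rw [← kulkarniNomizu_sub, hw, kulkarniNomizu_sub, kulkarniNomizu_smul,
          kulkarniNomizu_vecMulVec_add_symm, sub_zero]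

end IsRosenOn

end PlaneWaves

section DirectSums

variable {ι κ κ' : Type} [Fintype κ] [DecidableEq κ] [Fintype κ'] [DecidableEq κ']
  {J : Matrix κ κ ℝ} {S : (ι → ℝ) → Matrix κ' κ' ℝ} {U : Set (ι → ℝ)}

theorem IsNondegenerateOn.fromBlocks_zero [Fintype ι] (hS : IsNondegenerateOn S U) (hJ : J.IsSymm)
    (hJdet : IsUnit J.det) : IsNondegenerateOn (fun q => Matrix.fromBlocks J 0 0 (S q)) U where
  smooth := hS.smooth.fromBlocks_zero J
  isSymm p hp := hJ.fromBlocks (Matrix.transpose_zero) (hS.isSymm p hp)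
  isUnit_det p hp := by
    rw [Matrix.det_fromBlocks_zero₂₁]
    exact hJdet.mul (hS.isUnit_det p hp)

variable [DecidableEq ι] {h : (ι → ℝ) → Matrix (κ ⊕ κ') (κ ⊕ κ') ℝ} {p : ι → ℝ}
variable (hh : ∀ q ∈ U, h q = Matrix.fromBlocks J 0 0 (S q)) (hU : IsOpen U) (hp : p ∈ U) (a : ι)

include hh hU hp

theorem shapeOp_of_eq_fromBlocks (hdet : IsUnit (h p).det) :
    shapeOp a h p = Matrix.fromBlocks 0 0 0 (shapeOp a S p) := by
  rw [hh p hp, Matrix.det_fromBlocks_zero₂₁, IsUnit.mul_iff, ← Matrix.isUnit_iff_isUnit_det,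
    ← Matrix.isUnit_iff_isUnit_det] at hdet
  rw [shapeOp, partialDerivMatrix_congr_of_isOpen hU hh hp, partialDerivMatrix_fromBlocks_zero,
    hh p hp, Matrix.inv_fromBlocks_zero₂₁_of_isUnit_iff _ _ _ (iff_of_true hdet.1 hdet.2),
    Matrix.fromBlocks_multiply, Matrix.fromBlocks_smul]
  simp only [shapeOp, Matrix.mul_zero, Matrix.zero_mul, add_zero, zero_add, neg_zero, smul_zero]

variable (hdet : ∀ q ∈ U, IsUnit (h q).det)

include hdet

theorem tidalOp_of_eq_fromBlocks : tidalOp a h p = Matrix.fromBlocks 0 0 0 (tidalOp a S p) := by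
  have hA : ∀ q ∈ U, shapeOp a h q = Matrix.fromBlocks 0 0 0 (shapeOp a S q) :=
    fun q hq => shapeOp_of_eq_fromBlocks hh hU hq a (hdet q hq)
  rw [tidalOp, partialDerivMatrix_congr_of_isOpen hU hA hp, partialDerivMatrix_fromBlocks_zero,
    hA p hp, Matrix.fromBlocks_multiply, Matrix.fromBlocks_add]
  simp only [tidalOp, Matrix.mul_zero, Matrix.zero_mul, add_zero, zero_add]

theorem trace_tidalOp_of_eq_fromBlocks : (tidalOp a h p).trace = (tidalOp a S p).trace := by
  rw [tidalOp_of_eq_fromBlocks hh hU hp a hdet, Matrix.trace, Fintype.sum_sum_type]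
  simp only [Matrix.diag_apply, Matrix.fromBlocks_apply₁₁, Matrix.fromBlocks_apply₂₂,
    Matrix.zero_apply, Finset.sum_const_zero, zero_add]
  rfl

theorem tidalForm_of_eq_fromBlocks :
    tidalForm a h p = Matrix.fromBlocks 0 0 0 (tidalForm a S p) := by
  rw [tidalForm, tidalOp_of_eq_fromBlocks hh hU hp a hdet, hh p hp, Matrix.fromBlocks_multiply]
  simp only [tidalForm, Matrix.mul_zero, Matrix.zero_mul, add_zero, zero_add]

theorem covDerivTidalForm_of_eq_fromBlocks :
    covDerivTidalForm a h p = Matrix.fromBlocks 0 0 0 (covDerivTidalForm a S p) := by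
  have hE : ∀ q ∈ U, tidalForm a h q = Matrix.fromBlocks 0 0 0 (tidalForm a S q) :=
    fun q hq => tidalForm_of_eq_fromBlocks hh hU hq a hdet
  rw [covDerivTidalForm, partialDerivMatrix_congr_of_isOpen hU hE hp,
    partialDerivMatrix_fromBlocks_zero, hE p hp,
    shapeOp_of_eq_fromBlocks hh hU hp a (hdet p hp), Matrix.fromBlocks_transpose,
    Matrix.fromBlocks_multiply, Matrix.fromBlocks_multiply, sub_eq_add_neg, sub_eq_add_neg,
    Matrix.fromBlocks_neg, Matrix.fromBlocks_neg, Matrix.fromBlocks_add, Matrix.fromBlocks_add]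
  simp only [covDerivTidalForm, Matrix.transpose_zero, Matrix.mul_zero, Matrix.zero_mul, add_zero,
    zero_add, neg_zero, sub_eq_add_neg]

end DirectSums

section LinearSubstitution

variable {ι ι' κ κ' : Type} {a : ι} {b : ι'} {L : (ι → ℝ) →L[ℝ] ι' → ℝ} {V : Set (ι' → ℝ)}
  {p : ι → ℝ}

theorem partialDeriv_comp_clm [Finite ι] [DecidableEq ι] [Finite ι'] [DecidableEq ι']
    (hL : L (coordVec a) = coordVec b) {f : (ι' → ℝ) → ℝ} (hf : DifferentiableAt ℝ f (L p)) :
    partialDeriv a (fun q => f (L q)) p = partialDeriv b f (L p) := by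
  have := Fintype.ofFinite ι
  have := Fintype.ofFinite ι'
  have hchain := (hf.hasFDerivAt.comp p L.hasFDerivAt).fderiv
  rw [Function.comp_def] at hchain
  rw [partialDeriv, hchain, ContinuousLinearMap.comp_apply, hL, partialDeriv]

theorem partialDerivMatrix_comp_clm [Finite ι] [DecidableEq ι] [Fintype ι'] [DecidableEq ι']
    (hL : L (coordVec a) = coordVec b) {M : (ι' → ℝ) → Matrix κ κ' ℝ}
    (hM : SmoothEntriesOn M V) (hV : IsOpen V) (hp : L p ∈ V) :
    partialDerivMatrix a (fun q => M (L q)) p = partialDerivMatrix b M (L p) := by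
  ext i j
  exact partialDeriv_comp_clm hL (hM.differentiableAt hV hp i j)

namespace IsNondegenerateOn

variable [Fintype ι'] [Fintype κ] [DecidableEq κ] {S : (ι' → ℝ) → Matrix κ κ ℝ}

theorem comp_clm [Fintype ι] (hS : IsNondegenerateOn S V) (L : (ι → ℝ) →L[ℝ] ι' → ℝ) :
    IsNondegenerateOn (fun q => S (L q)) (L ⁻¹' V) where
  smooth := hS.smooth.comp L.contDiff
  isSymm p hp := hS.isSymm (L p) hp
  isUnit_det p hp := hS.isUnit_det (L p) hp

variable [Finite ι] [DecidableEq ι] [DecidableEq ι'] (hS : IsNondegenerateOn S V) (hV : IsOpen V)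
  (hL : L (coordVec a) = coordVec b) (hp : L p ∈ V)

include hS hV hL hp

theorem shapeOp_comp_clm : shapeOp a (fun q => S (L q)) p = shapeOp b S (L p) := by
  rw [shapeOp, partialDerivMatrix_comp_clm hL hS.smooth hV hp, shapeOp]

theorem tidalOp_comp_clm : tidalOp a (fun q => S (L q)) p = tidalOp b S (L p) := by
  have hA : ∀ q ∈ L ⁻¹' V, shapeOp a (fun q => S (L q)) q = shapeOp b S (L q) :=
    fun q hq => hS.shapeOp_comp_clm hV hL hq
  rw [tidalOp, partialDerivMatrix_congr_of_isOpen (hV.preimage L.continuous) hA hp,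
    partialDerivMatrix_comp_clm hL (hS.smooth_shapeOp hV b) hV hp, hA p hp, tidalOp]

theorem covDerivTidalForm_comp_clm :
    covDerivTidalForm a (fun q => S (L q)) p = covDerivTidalForm b S (L p) := by
  have hE : ∀ q ∈ L ⁻¹' V, tidalForm a (fun q => S (L q)) q = tidalForm b S (L q) :=
    fun q hq => by rw [tidalForm, hS.tidalOp_comp_clm hV hL hq, tidalForm]
  rw [covDerivTidalForm, partialDerivMatrix_congr_of_isOpen (hV.preimage L.continuous) hE hp,
    partialDerivMatrix_comp_clm hL (hS.smooth_tidalForm hV b) hV hp, hE p hp,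
    hS.shapeOp_comp_clm hV hL hp, covDerivTidalForm]

end IsNondegenerateOn

end LinearSubstitution

section Axis

variable {m : ℕ} {g : MetricField (RiemIdx m)} {U : Set (RiemIdx m → ℝ)}

/-- The matrix `(g_ij)_{i,j ≥ 2}` of the metrics induced by `g` on the level sets of `r`. -/
def transverseMetric (g : MetricField (RiemIdx m)) (q : RiemIdx m → ℝ) : Matrix (Fin m) (Fin m) ℝ :=
  (g q).toBlocks₂₂

/-- The linear map `(r, t, x²,…,xⁿ) ↦ (r, 0,…,0)`. -/
noncomputable def axisProj (m : ℕ) : (LorIdx m → ℝ) →L[ℝ] RiemIdx m → ℝ :=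
  (ContinuousLinearMap.proj (Sum.inl 0)).smulRight (coordVec (Sum.inl 0))

theorem axisProj_apply (p : LorIdx m → ℝ) : axisProj m p = axisPoint m (p (Sum.inl 0)) := by
  ext (i | i)
  · simp [axisProj, axisPoint, Subsingleton.elim i 0]
  · simp [axisProj, axisPoint]

theorem axisProj_coordVec : axisProj m (coordVec (Sum.inl 0)) = coordVec (Sum.inl 0) := by
  simp [axisProj]

theorem planeWaveDomain_eq_preimage : planeWaveDomain U = axisProj m ⁻¹' U := by
  ext p
  rw [Set.mem_preimage, axisProj_apply]
  rfl

theorem isOpen_planeWaveDomain (hU : IsOpen U) : IsOpen (planeWaveDomain U) := by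
  rw [planeWaveDomain_eq_preimage]
  exact hU.preimage (axisProj m).continuous

theorem axisProj_mem {p : LorIdx m → ℝ} (hp : p ∈ planeWaveDomain U) : axisProj m p ∈ U := by
  rwa [planeWaveDomain_eq_preimage] at hp

theorem planeWave_eq_fromBlocks (g : MetricField (RiemIdx m)) (p : LorIdx m → ℝ) :
    planeWave g p =
      Matrix.fromBlocks !![0, 1; 1, 0] 0 0 (transverseMetric g (axisProj m p)) := by
  rw [axisProj_apply]
  rfl

theorem IsRiemannianOn.isNondegenerateOn {ι : Type} [Fintype ι] [DecidableEq ι]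
    {g : MetricField ι} {U : Set (ι → ℝ)} (hg : IsRiemannianOn g U) : IsNondegenerateOn g U where
  smooth := hg.1
  isSymm p hp := (hg.2 p hp).isHermitian
  isUnit_det p hp := (hg.2 p hp).det_pos.ne'.isUnit

namespace IsSemigeodesicOn

theorem eq_fromBlocks (hsg : IsSemigeodesicOn g U) :
    ∀ q ∈ U, g q = Matrix.fromBlocks 1 0 0 (transverseMetric g q) := by
  intro q hq
  obtain ⟨hrr, hrx⟩ := hsg q hq
  ext (i | i) (j | j)
  · rw [Subsingleton.elim i 0, Subsingleton.elim j 0, hrr]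
    rfl
  · rw [Subsingleton.elim i 0, (hrx j).1]
    rfl
  · rw [Subsingleton.elim j 0, (hrx i).2]
    rfl
  · rfl

theorem hasConstantRowOn (hsg : IsSemigeodesicOn g U) : HasConstantRowOn g (Sum.inl 0) U := by
  refine ⟨coordVec (Sum.inl 0), fun q hq => ?_⟩
  rw [hsg.eq_fromBlocks q hq]
  ext (j | j)
  · simp [Subsingleton.elim j 0]
  · simp

variable (hsg : IsSemigeodesicOn g U) (hg : IsNondegenerateOn g U)

include hsg hg

theorem isNondegenerateOn_transverseMetric : IsNondegenerateOn (transverseMetric g) U where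
  smooth i j := hg.smooth (Sum.inr i) (Sum.inr j)
  isSymm p hp := (hg.isSymm p hp).submatrix Sum.inr
  isUnit_det p hp := by
    have hdet := hg.isUnit_det p hp
    rwa [hsg.eq_fromBlocks p hp, Matrix.det_fromBlocks_zero₂₁, Matrix.det_one, one_mul] at hdet

theorem isRosenOn_planeWave :
    IsRosenOn (planeWave g) (Sum.inl 0) (Sum.inl 1) (planeWaveDomain U) where
  nondegenerate := by
    rw [planeWaveDomain_eq_preimage, funext (planeWave_eq_fromBlocks g)]
    refine ((hsg.isNondegenerateOn_transverseMetric hg).comp_clm (axisProj m)).fromBlocks_zero ?_ ?_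
    · simp [Matrix.IsSymm, ← Matrix.ext_iff, Fin.forall_fin_two]
    · simp
  dependsOn p q hpq := by rw [planeWave, planeWave, hpq _ rfl]
  row_eq p _ := by
    ext (j | j)
    · fin_cases j <;> simp [planeWave]
    · simp [planeWave]
  ne := by simp

variable (hU : IsOpen U) {p : LorIdx m → ℝ} (hp : p ∈ planeWaveDomain U)

include hU hp

theorem trace_tidalOp_planeWave :
    (tidalOp (Sum.inl 0) (planeWave g) p).trace =
      (tidalOp (Sum.inl 0) g (axisProj m p)).trace := by
  rw [trace_tidalOp_of_eq_fromBlocks (fun q _ => planeWave_eq_fromBlocks g q)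
      (isOpen_planeWaveDomain hU) hp _ (hsg.isRosenOn_planeWave hg).nondegenerate.isUnit_det,
    (hsg.isNondegenerateOn_transverseMetric hg).tidalOp_comp_clm hU axisProj_coordVec
      (axisProj_mem hp),
    trace_tidalOp_of_eq_fromBlocks hsg.eq_fromBlocks hU (axisProj_mem hp) _ hg.isUnit_det]

theorem covDerivTidalForm_planeWave :
    covDerivTidalForm (Sum.inl 0) (planeWave g) p =
      Matrix.fromBlocks 0 0 0 (covDerivTidalForm (Sum.inl 0) g (axisProj m p)).toBlocks₂₂ := by
  rw [covDerivTidalForm_of_eq_fromBlocks (fun q _ => planeWave_eq_fromBlocks g q)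
      (isOpen_planeWaveDomain hU) hp _ (hsg.isRosenOn_planeWave hg).nondegenerate.isUnit_det,
    (hsg.isNondegenerateOn_transverseMetric hg).covDerivTidalForm_comp_clm hU axisProj_coordVec
      (axisProj_mem hp),
    covDerivTidalForm_of_eq_fromBlocks hsg.eq_fromBlocks hU (axisProj_mem hp) _ hg.isUnit_det,
    Matrix.toBlocks_fromBlocks₂₂]

theorem ricci_planeWave (α β : LorIdx m) :
    ricci (planeWave g) α β p =
      ricci g (Sum.inl 0) (Sum.inl 0) (axisProj m p) * (drForm α * drForm β) := by
  rw [(hsg.isRosenOn_planeWave hg).ricci_eq (isOpen_planeWaveDomain hU) hp,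
    hsg.trace_tidalOp_planeWave hg hU hp,
    hsg.hasConstantRowOn.ricci_eq_neg_trace_tidalOp hg hU (axisProj_mem hp)]
  rfl

theorem covDerivRicci_planeWave (γ α β : LorIdx m) :
    covDerivRicci (planeWave g) γ α β p =
      covDerivRicci g (Sum.inl 0) (Sum.inl 0) (Sum.inl 0) (axisProj m p) *
        (drForm γ * drForm α * drForm β) := by
  have htrace : DifferentiableAt ℝ (fun q => (tidalOp (Sum.inl 0) g q).trace) (axisProj m p) :=
    DifferentiableAt.fun_sum fun i _ =>
      (hg.smooth_tidalOp hU _).differentiableAt hU (axisProj_mem hp) i i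
  rw [(hsg.isRosenOn_planeWave hg).covDerivRicci_eq (isOpen_planeWaveDomain hU) hp,
    partialDeriv_congr_of_isOpen (isOpen_planeWaveDomain hU)
      (fun q hq => hsg.trace_tidalOp_planeWave hg hU hq) hp,
    partialDeriv_comp_clm axisProj_coordVec htrace,
    hsg.hasConstantRowOn.covDerivRicci_eq hg hU (axisProj_mem hp)]
  rfl

theorem covDerivRiemann_planeWave (γ i j k l : LorIdx m) :
    covDerivRiemann (planeWave g) γ i j k l p = drForm γ *
      kulkarniNomizu (Matrix.vecMulVec drForm drForm)
        (Matrix.fromBlocks 0 0 0 (Matrix.of fun x y =>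
          covDerivRiemann g (Sum.inl 0) (Sum.inl 0) (Sum.inr x) (Sum.inl 0) (Sum.inr y)
            (axisProj m p))) i j k l := by
  simp only [hsg.hasConstantRowOn.covDerivRiemann_eq_covDerivTidalForm hg hU (axisProj_mem hp)]
  rw [(hsg.isRosenOn_planeWave hg).covDerivRiemann_eq (isOpen_planeWaveDomain hU) hp,
    hsg.covDerivTidalForm_planeWave hg hU hp]
  rfl

theorem ricci_planeWave_of_isEinsteinOn {lam : ℝ} (hE : IsEinsteinOn g U lam) (α β : LorIdx m) :
    ricci (planeWave g) α β p = lam * (drForm α * drForm β) := by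
  rw [hsg.ricci_planeWave hg hU hp, hE _ (axisProj_mem hp), (hsg _ (axisProj_mem hp)).1, mul_one]

omit hp

theorem isLocallySymmetricOn_planeWave (hloc : IsLocallySymmetricOn g U) :
    IsLocallySymmetricOn (planeWave g) (planeWaveDomain U) := by
  intro p hp γ i j k l
  rw [hsg.covDerivRiemann_planeWave hg hU hp]
  simp only [hloc _ (axisProj_mem hp)]
  rw [show (Matrix.of fun _ _ => (0 : ℝ) : Matrix (Fin m) (Fin m) ℝ) = 0 from rfl,
    Matrix.fromBlocks_zero, kulkarniNomizu_zero_right, mul_zero]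

theorem hasParallelRicciOn_planeWave (hpar : HasParallelRicciOn g U) :
    HasParallelRicciOn (planeWave g) (planeWaveDomain U) := by
  intro p hp γ α β
  rw [hsg.covDerivRicci_planeWave hg hU hp, hpar _ (axisProj_mem hp), zero_mul]

end IsSemigeodesicOn

end Axis

section Lorentzian

open scoped MatrixOrder in
theorem exists_transpose_mul_mul_eq_one {κ : Type} [Fintype κ] [DecidableEq κ]
    {M : Matrix κ κ ℝ} (hM : M.PosDef) :
    ∃ Q : Matrix κ κ ℝ, IsUnit Q.det ∧ Q.transpose * M * Q = 1 := by
  obtain ⟨B, hB, hMB⟩ :=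
    CStarAlgebra.isStrictlyPositive_iff_eq_star_mul_self.1 hM.isStrictlyPositive
  rw [Matrix.isUnit_iff_isUnit_det] at hB
  rw [Matrix.star_eq_conjTranspose, Matrix.conjTranspose_eq_transpose_of_trivial] at hMB
  refine ⟨B⁻¹, Matrix.isUnit_nonsing_inv_det _ hB, ?_⟩
  rw [hMB, ← Matrix.mul_assoc, ← Matrix.transpose_mul, Matrix.mul_assoc,
    Matrix.mul_nonsing_inv _ hB, Matrix.transpose_one, Matrix.one_mul]

theorem isLorentzianOn_fromBlocks_zero {κ : Type} [Fintype κ] [DecidableEq κ]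
    {S : (Fin 2 ⊕ κ → ℝ) → Matrix κ κ ℝ} {U : Set (Fin 2 ⊕ κ → ℝ)} (hS : SmoothEntriesOn S U)
    (hpos : ∀ p ∈ U, (S p).PosDef) :
    IsLorentzianOn (fun p => Matrix.fromBlocks !![0, 1; 1, 0] 0 0 (S p)) U := by
  refine ⟨hS.fromBlocks_zero _, fun p hp => ?_⟩
  obtain ⟨Q, hQ, hQS⟩ := exists_transpose_mul_mul_eq_one (hpos p hp)
  set N : Matrix (Fin 2) (Fin 2) ℝ := !![1, 1; 1 / 2, -1 / 2] with hN
  have hNdet : N.det = -1 := by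
    rw [hN, Matrix.det_fin_two_of]
    norm_num
  have hnull : N.transpose * !![0, 1; 1, 0] * N = Matrix.diagonal ![1, -1] := by
    ext i j
    fin_cases i <;> fin_cases j <;> norm_num [hN, Matrix.mul_apply, Fin.sum_univ_two]
  have hsign : (fun i : Fin 2 ⊕ κ => if i = Sum.inl 1 then (-1 : ℝ) else 1) =
      Sum.elim ![1, -1] fun _ => 1 := by
    ext (i | i)
    · fin_cases i <;> simp
    · simp
  refine ⟨Sum.inl 1, Matrix.fromBlocks N 0 0 Q, ?_, ?_⟩
  · rw [Matrix.det_fromBlocks_zero₂₁, hNdet]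
    exact isUnit_one.neg.mul hQ
  · rw [hsign, ← Matrix.fromBlocks_diagonal, Matrix.diagonal_one, ← hnull, ← hQS,
      Matrix.fromBlocks_transpose, Matrix.fromBlocks_multiply, Matrix.fromBlocks_multiply]
    simp only [Matrix.transpose_zero, Matrix.mul_zero, Matrix.zero_mul, add_zero, zero_add]

theorem IsRiemannianOn.isLorentzianOn_planeWave {m : ℕ} {g : MetricField (RiemIdx m)}
    {U : Set (RiemIdx m → ℝ)} (hg : IsRiemannianOn g U) :
    IsLorentzianOn (planeWave g) (planeWaveDomain U) := by
  have hS : SmoothEntriesOn (transverseMetric g) U := fun i j => hg.1 (Sum.inr i) (Sum.inr j)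
  rw [planeWaveDomain_eq_preimage, funext (planeWave_eq_fromBlocks g)]
  exact isLorentzianOn_fromBlocks_zero (hS.comp (axisProj m).contDiff)
    fun p hp => (hg.2 _ hp).submatrix Sum.inr_injective

end Lorentzian

section PlaneWaveLimit

theorem partialDeriv_mulVec {ι κ : Type} [Fintype ι] [DecidableEq ι] (J : Matrix κ ι ℝ) (i : ι)
    (a : κ) (p : ι → ℝ) : partialDeriv i (fun q => J.mulVec q a) p = J a i := by
  have hlin : (fun q => J.mulVec q a) = (LinearMap.proj a ∘ₗ J.mulVecLin).toContinuousLinearMap :=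
    rfl
  rw [partialDeriv, hlin, ContinuousLinearMap.fderiv]
  simp

theorem pullbackMetric_mulVec {ι κ : Type} [Fintype ι] [DecidableEq ι] [Fintype κ]
    (J : Matrix κ ι ℝ) (g : MetricField κ) (p : ι → ℝ) :
    pullbackMetric J.mulVec g p = J.transpose * g (J.mulVec p) * J := by
  ext i j
  simp only [pullbackMetric, partialDeriv_mulVec, Matrix.of_apply, Matrix.mul_apply,
    Matrix.transpose_apply, Finset.sum_mul]
  rw [Finset.sum_comm]
  exact Finset.sum_congr rfl fun b _ => Finset.sum_congr rfl fun a _ => by ring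

theorem pullbackMetric_productLorentz {ι κ : Type} [Fintype ι] [DecidableEq ι] [Fintype κ]
    (T : Matrix (Fin 1) ι ℝ) (X : Matrix κ ι ℝ) (g : MetricField κ) (p : ι → ℝ) :
    pullbackMetric (Matrix.fromRows T X).mulVec (productLorentz g) p =
      X.transpose * g (X.mulVec p) * X - T.transpose * T := by
  have hX : (fun i => (Matrix.fromRows T X).mulVec p (Sum.inr i)) = X.mulVec p := rfl
  have hneg : T.transpose * !![(-1 : ℝ)] = -T.transpose := by
    ext i j
    simp [Matrix.mul_apply, Subsingleton.elim j 0]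
  rw [pullbackMetric_mulVec, productLorentz, hX, Matrix.transpose_fromRows,
    Matrix.fromCols_mul_fromBlocks, Matrix.fromCols_mul_fromRows, hneg, Matrix.mul_zero,
    Matrix.mul_zero, add_zero, zero_add, Matrix.neg_mul, neg_add_eq_sub]

/-- The spatial part `(r, t, x^i) ↦ (r + ε²t/2, εx^i)` of the coordinate change that defines the
plane wave limit. -/
noncomputable def penroseSpatial (m : ℕ) (ε : ℝ) : Matrix (RiemIdx m) (LorIdx m) ℝ :=
  Matrix.fromBlocks !![1, ε ^ 2 / 2] 0 0 (ε • 1)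

/-- The time component `(r, t, x^i) ↦ r - ε²t/2` of the coordinate change that defines the plane
wave limit. -/
noncomputable def penroseTime (m : ℕ) (ε : ℝ) : Matrix (Fin 1) (LorIdx m) ℝ :=
  Matrix.fromCols !![1, -(ε ^ 2 / 2)] 0

variable {m : ℕ}

theorem fromNullCoords_penroseScaling_relabel (ε : ℝ) (q : LorIdx m → ℝ) :
    fromNullCoords m (penroseScaling m ε (relabel m q)) =
      (Matrix.fromRows (penroseTime m ε) (penroseSpatial m ε)).mulVec q := by
  have hroot (x : ℝ) : √2 * x / √2 = x := mul_div_cancel_left₀ x (by positivity)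
  have hroot' (x : ℝ) : x / √2 / √2 = x / 2 := by
    rw [div_div, Real.mul_self_sqrt zero_le_two]
  ext (i | i | i)
  · have hr : (√2 * q (Sum.inl 0) - ε ^ 2 * (q (Sum.inl 1) / √2)) / √2 =
        q (Sum.inl 0) - ε ^ 2 / 2 * q (Sum.inl 1) := by
      rw [sub_div, hroot, mul_div_assoc, hroot']
      ring
    simpa [fromNullCoords, penroseScaling, relabel, penroseTime, Matrix.mulVec, dotProduct,
      sub_eq_add_neg] using hr
  · have hr : (√2 * q (Sum.inl 0) + ε ^ 2 * (q (Sum.inl 1) / √2)) / √2 =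
        q (Sum.inl 0) + ε ^ 2 / 2 * q (Sum.inl 1) := by
      rw [add_div, hroot, mul_div_assoc, hroot']
      ring
    simpa [fromNullCoords, penroseScaling, relabel, penroseSpatial, Matrix.mulVec, dotProduct]
      using hr
  · simp [fromNullCoords, penroseScaling, relabel, penroseSpatial, Matrix.mulVec, dotProduct,
      Matrix.one_apply]

theorem penroseSpatial_zero_mulVec (p : LorIdx m → ℝ) :
    (penroseSpatial m 0).mulVec p = axisProj m p := by
  ext (i | i)
  · simp [penroseSpatial, axisProj, Matrix.mulVec, dotProduct, Subsingleton.elim i 0]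
  · simp [penroseSpatial, axisProj, Matrix.mulVec, dotProduct]

theorem continuous_penroseSpatial_mulVec (p : LorIdx m → ℝ) :
    Continuous fun ε => (penroseSpatial m ε).mulVec p := by
  unfold penroseSpatial
  fun_prop

theorem transpose_penroseSpatial_mul_mul (ε : ℝ) (S : Matrix (Fin m) (Fin m) ℝ) :
    (penroseSpatial m ε).transpose *
        (Matrix.fromBlocks 1 0 0 S : Matrix (RiemIdx m) (RiemIdx m) ℝ) * penroseSpatial m ε =
      Matrix.fromBlocks (!![1, ε ^ 2 / 2].transpose * !![1, ε ^ 2 / 2]) 0 0 (ε ^ 2 • S) := by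
  rw [penroseSpatial, Matrix.fromBlocks_transpose, Matrix.fromBlocks_multiply,
    Matrix.fromBlocks_multiply]
  simp [smul_smul, sq]

variable {g : MetricField (RiemIdx m)} {U : Set (RiemIdx m → ℝ)}

theorem IsSemigeodesicOn.rescaledMetric_eq (hsg : IsSemigeodesicOn g U) {p : LorIdx m → ℝ} {ε : ℝ}
    (hε : ε ≠ 0) (hp : (penroseSpatial m ε).mulVec p ∈ U) :
    rescaledMetric g ε p = Matrix.fromBlocks !![0, 1; 1, 0] 0 0
      (transverseMetric g ((penroseSpatial m ε).mulVec p)) := by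
  have hnull : !![1, ε ^ 2 / 2].transpose * !![1, ε ^ 2 / 2]
      + -(!![1, -(ε ^ 2 / 2)].transpose * !![1, -(ε ^ 2 / 2)]) = ε ^ 2 • !![0, 1; 1, 0] := by
    ext i j
    fin_cases i <;> fin_cases j <;> simp [Matrix.mul_apply]
  have htime : (penroseTime m ε).transpose * penroseTime m ε =
      Matrix.fromBlocks (!![1, -(ε ^ 2 / 2)].transpose * !![1, -(ε ^ 2 / 2)]) 0 0 0 := by
    rw [penroseTime, Matrix.transpose_fromCols, Matrix.fromRows_mul_fromCols]
    simp only [Matrix.transpose_zero, Matrix.mul_zero, Matrix.zero_mul]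
  rw [rescaledMetric, funext (fromNullCoords_penroseScaling_relabel ε),
    pullbackMetric_productLorentz, hsg.eq_fromBlocks _ hp, inv_smul_eq_iff₀ (pow_ne_zero 2 hε),
    transpose_penroseSpatial_mul_mul, htime, sub_eq_add_neg, Matrix.fromBlocks_neg,
    Matrix.fromBlocks_add, hnull, Matrix.fromBlocks_smul]
  simp only [neg_zero, add_zero, smul_zero]

theorem IsSemigeodesicOn.tendsto_rescaledMetric (hsg : IsSemigeodesicOn g U)
    (hS : ContinuousOn (transverseMetric g) U) (hU : IsOpen U)
    {p : LorIdx m → ℝ} (hp : p ∈ planeWaveDomain U) :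
    Tendsto (fun ε : ℝ => rescaledMetric g ε p) (𝓝[≠] 0) (𝓝 (planeWave g p)) := by
  have hpoint : Tendsto (fun ε => (penroseSpatial m ε).mulVec p) (𝓝[≠] 0) (𝓝 (axisProj m p)) := by
    rw [← penroseSpatial_zero_mulVec]
    exact (continuous_penroseSpatial_mulVec p).continuousAt.mono_left nhdsWithin_le_nhds
  have heq : ∀ᶠ ε in 𝓝[≠] (0 : ℝ), Matrix.fromBlocks !![0, 1; 1, 0] 0 0
      (transverseMetric g ((penroseSpatial m ε).mulVec p)) = rescaledMetric g ε p := by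
    filter_upwards [hpoint (hU.mem_nhds (axisProj_mem hp)), self_mem_nhdsWithin] with ε hε hne
    exact (hsg.rescaledMetric_eq hne hε).symm
  have hblock : Continuous fun S : Matrix (Fin m) (Fin m) ℝ =>
      Matrix.fromBlocks !![(0 : ℝ), 1; 1, 0] 0 0 S := by
    fun_prop
  rw [planeWave_eq_fromBlocks]
  exact ((hblock.tendsto _).comp
    ((hS.continuousAt (hU.mem_nhds (axisProj_mem hp))).tendsto.comp hpoint)).congr' heq

end PlaneWaveLimit

theorem mainTheorem4 (m : ℕ) (U : Set (RiemIdx m → ℝ)) (hU : IsOpen U)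
    (g : MetricField (RiemIdx m)) (hg : IsRiemannianOn g U) (hsg : IsSemigeodesicOn g U) :
    -- `planeWave g` is a Lorentzian metric and is the plane wave limit of `-(dt)² + g`
    IsLorentzianOn (planeWave g) (planeWaveDomain U) ∧
    (∀ p ∈ planeWaveDomain U,
      Tendsto (fun ε : ℝ => rescaledMetric g ε p) (𝓝[>] 0) (𝓝 (planeWave g p))) ∧
    -- 1. the Einstein case: `Ric = lam (dr)²`
    (∀ lam : ℝ, IsEinsteinOn g U lam →
      ∀ p ∈ planeWaveDomain U, ∀ α β : LorIdx m,
        ricci (planeWave g) α β p = lam * (drForm α * drForm β)) ∧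
    -- 2. local symmetry
    (IsLocallySymmetricOn g U →
      IsLocallySymmetricOn (planeWave g) (planeWaveDomain U)) ∧
    -- 3. parallel Ricci tensor
    (HasParallelRicciOn g U →
      HasParallelRicciOn (planeWave g) (planeWaveDomain U)) := by
  have hnd : IsNondegenerateOn g U := hg.isNondegenerateOn
  have hS : ContinuousOn (transverseMetric g) U := continuousOn_pi.2 fun i =>
    continuousOn_pi.2 fun j => (hg.1 (Sum.inr i) (Sum.inr j)).continuousOn
  refine ⟨hg.isLorentzianOn_planeWave, fun p hp => ?_, fun lam hE p hp => ?_, ?_, ?_⟩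
  · exact (hsg.tendsto_rescaledMetric hS hU hp).mono_left (nhdsGT_le_nhdsNE 0)
  · exact hsg.ricci_planeWave_of_isEinsteinOn hnd hU hp hE
  · exact hsg.isLocallySymmetricOn_planeWave hnd hU
  · exact hsg.hasParallelRicciOn_planeWave hnd hU
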